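/- Let $d>1$. Label the vertices of the grid $\mathbb{Z}^d$ by iid uniform random variables in $[0,1]$; let $\mu$ be the law of this labeling on $[0,1]^{\mathbb{Z}^d}$. For a finite set $b$, a *finitary factor of iid* (ffiid) is a measurable map $F:[0,1]^{\mathbb{Z}^d}\to b^{\mathbb{Z}^d}$ that commutes with all translations of $\mathbb{Z}^d$ and whose *coding radius* $$R_F(x)=\min\{r\in\mathbb{N}:\ F(x')(\mathbf 0)=F(x)(\mathbf 0)\text{ for every }x'\text{ that agrees with }x\text{ on the ball of radius }r\text{ around }\mathbf 0\}$$ (ball in the graph distance of the grid; $\min\emptyset=\infty$) is finite for $\mu$-almost every $x$. It *solves* a locally checkable problem $\Pi$ on $\mathbb{Z}^d$ with color set $b$ if $F(x)$ is a $\Pi$-coloring for $\mu$-almost every $x$. For $\alpha\in[0,\infty)$ the $\alpha$-moment of $R_F$ is $\mathbb{E}(R_F^{\alpha})$, and ${\bf M}(\Pi)\in[0,\infty]$ is the supremum of all $\alpha\in[0,\infty)$ such that some ffiid solution $F$ of $\Pi$ has finite $\alpha$-moment of $R_F$. Let $\Pi^d_{\chi,3}$ be the problem of proper vertex $3$-coloring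 of $\mathbb{Z}^d$, where $\mathbb{Z}^d$ carries the Cayley graph structure of the standard generators. Then: 1. every ffiid solution $F$ of $\Pi^d_{\chi,3}$ satisfies $\mathbb{E}(R_F)=\infty$; 2. there is an ffiid solution $F$ of $\Pi^d_{\chi,3}$ such that $\mathbb{E}(R_F^{1-\varepsilon})<\infty$ for every $\varepsilon\in(0,1]$; 3. ${\bf M}(\Pi^d_{\chi,3})=1$. -/

import Mathlib

open MeasureTheory
open scoped ENNReal NNReal unitInterval

noncomputable section

namespace FFIID

/-- The vertices of the grid `ℤ^d`. -/
abbrev Grid (d : ℕ) : Type := Fin d → ℤ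

/-- The infinite grid: the Cayley graph of `ℤ^d` with respect to the standard generators. -/
def gridGraph (d : ℕ) : SimpleGraph (Grid d) :=
  SimpleGraph.fromRel fun u v => ∃ i : Fin d, v = u + Pi.single i 1

/-- The ball of radius `r` around the origin in the graph distance of the grid, which is the
`ℓ¹`-distance. -/
def ball (d r : ℕ) : Set (Grid d) := {v | ∑ i, (v i).natAbs ≤ r}

/-- The shift action of `ℤ^d` on labelings of the grid, `(g · x)(h) = x (g + h)`. -/
def shift {d : ℕ} {A : Type*} (g : Grid d) (x : Grid d → A) : Grid d → A := fun h => x (g + h)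

/-- A locally checkable problem without inputs on `ℤ^d`, with `b` colors: a locality `radius` and
a set of allowed patterns on the ball of that radius. -/
structure LCL (d b : ℕ) where
  radius : ℕ
  allowed : Set (ball d radius → Fin b)

/-- The set of all `Π`-colorings of `ℤ^d`: around every vertex `v` one sees an allowed pattern. -/
def LCL.solutions {d b : ℕ} (P : LCL d b) : Set (Grid d → Fin b) :=
  {c | ∀ v : Grid d, (fun u : ball d P.radius => shift v c u) ∈ P.allowed}

/-- Proper vertex `k`-coloring of `ℤ^d` as a locally checkable problem of locality `1`: the color
at the root differs from the colors at all its neighbours. -/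
def properColoring (d k : ℕ) : LCL d k where
  radius := 1
  allowed := {p | ∀ u v : ball d 1, (u : Grid d) = 0 → (gridGraph d).Adj u v → p u ≠ p v}

/-- Labelings of the vertices of `ℤ^d` by real numbers in `[0,1]`. -/
abbrev Labeling (d : ℕ) : Type := Grid d → I

/-- The law of the iid uniform labeling: the product of the Lebesgue measures on `[0,1]`. -/
def iidMeasure (d : ℕ) : Measure (Labeling d) :=
  Measure.infinitePi fun _ : Grid d => (volume : Measure I)

/-- The color that `F` gives to the origin depends only on the labels in the ball of radius `r`,
when the labeling is `x`. -/
def DeterminedAt {d b : ℕ} (F : Labeling d → Grid d → Fin b) (x : Labeling d) (r : ℕ) : Prop :=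
  ∀ x' : Labeling d, (∀ v ∈ ball d r, x' v = x v) → F x' 0 = F x 0

/-- The coding radius `R_F(x)`: the smallest radius of a ball around the origin whose labels
determine the color of the origin, and `⊤` if there is none. -/
def codingRadius {d b : ℕ} (F : Labeling d → Grid d → Fin b) (x : Labeling d) : ℕ∞ :=
  ⨅ (r : ℕ) (_ : DeterminedAt F x r), (r : ℕ∞)

/-- Finitary factors of iid: measurable equivariant maps with almost surely finite coding
radius. -/
structure IsFFIID {d b : ℕ} (F : Labeling d → Grid d → Fin b) : Prop where
  measurable : Measurable F
  equivariant : ∀ (g : Grid d) (x : Labeling d), F (shift g x) = shift g (F x)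
  finitary : ∀ᵐ x ∂(iidMeasure d), codingRadius F x < ⊤

/-- `F` is a finitary factor of iid that solves the locally checkable problem `P`: its output is
almost surely a `P`-coloring. -/
def IsFFIIDSolution {d b : ℕ} (P : LCL d b) (F : Labeling d → Grid d → Fin b) : Prop :=
  IsFFIID F ∧ ∀ᵐ x ∂(iidMeasure d), F x ∈ P.solutions

/-- The `α`-moment `𝔼 (R_F ^ α)` of the coding radius, as an extended nonnegative number. -/
def codingMoment {d b : ℕ} (F : Labeling d → Grid d → Fin b) (α : ℝ) : ℝ≥0∞ :=
  ∫⁻ x, ((codingRadius F x : ℕ∞) : ℝ≥0∞) ^ α ∂(iidMeasure d)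

/-- The invariant `𝐌(Π) ∈ [0,∞]`: the supremum of all `α ∈ [0,∞)` for which `Π` has an ffiid
solution whose coding radius has finite `α`-moment. -/
def momentInvariant {d b : ℕ} (P : LCL d b) : ℝ≥0∞ :=
  ⨆ (α : ℝ≥0) (_ : ∃ F, IsFFIIDSolution P F ∧ codingMoment F α < ⊤), (α : ℝ≥0∞)

end FFIID

end

/-!
The theorem has two halves: no finitary factor that is a proper 3-coloring has a coding radius of
finite mean, and one such factor has finite moments of every order below `1`.

*Infinite mean.* A proper 3-coloring of `ℤ^d` lifts, on each plane, to a height function whose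
increments along edges are `±1` (`inc`), and the increment between two vertices can be read along
any path in the plane (`rowInc_add_colInc`). Suppose that the coding radius has finite mean. Then a
path can be inspected with balls whose radii grow linearly with the distance to its ends, at a small
total error: the probabilities that a ball of radius `i / 4` does not suffice are summable
(`tsum_undet_le`). By a detour, the increment along a long horizontal segment is, up to a small
error, a function of the labels near the two ends (`measure_rowInc_mix_ne_le`). Now delete `N`
columns in the middle of a segment from the labeling. The labels near both ends do not notice, so
the change of the increment is nearly independent of the labeling, hence nearly a constant
(`exists_measure_heightDrop_ne_le`), with an error that is uniform in `N`. This constant is additive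
in `N`, is odd for `N = 1`, and is at most `N + O(1)` in absolute value; hence it is `±N`
(`exists_slope`). So all but a bounded number of steps of a long segment go in the same direction,
and by stationarity a given long segment is most likely monotone (`measure_exists_inc_ne_le`). Then
the colors at two far apart vertices whose distance is a multiple of `3` agree; as they are almost
independent, the color of a vertex is almost constant, which is absurd for a proper coloring
(`false_of_measure_exists_inc_ne_le`).

*Moments below `1`.* The color is found by a hierarchy of clusters. On each scale `k`,
independently, random boxes of radius about `boxRadius k` are placed. The vertices that lie in a box
and are not close to the boundary of any box form the core; it splits into far apart pieces of
bounded diameter, according to the set of boxes that contain a vertex. The core is enlarged so that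
the clusters of smaller scale near it end up in its interior, and its pieces remain bounded: these
are the clusters of scale `k` (`supDist_add_two_le_reach`). Every cluster is given a parity, that
is, a 2-coloring. Where a smaller cluster of the other parity lies within a cluster, the 2-coloring
is deformed near it into a 3-coloring that raises the height by `3`, which amounts to the other
parity (`coloringInvariant`). A vertex lies outside of the core of scale `k` with a probability of
order at most `k / 2 ^ k` (`scaleLaw_notMem_core_le`), while the diameters of the clusters grow by a
factor of order `2 ^ k`. As the scales are independent, these probabilities multiply, and every
moment of order less than `1` is finite (`summable_reach_rpow_mul_prod_gapBound`,
`codingMoment_toastFactor_lt_top`).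
-/

noncomputable section

namespace FFIID

section

variable {d b : ℕ}

/-! ### Resampling an iid labeling -/

instance : IsProbabilityMeasure (iidMeasure d) := by
  unfold iidMeasure; infer_instance

/-- The labeling that reads the second of two labelings on `A` and the first one elsewhere, after
relabeling the vertices by `e`. -/
def mix (A : Set (Grid d)) (e : Grid d → Grid d) (z : Labeling d × Labeling d) : Labeling d :=
  open Classical in fun v => if v ∈ A then z.2 (e v) else z.1 (e v)

lemma mix_of_mem {A : Set (Grid d)} {e : Grid d → Grid d} {z : Labeling d × Labeling d}
    {v : Grid d} (h : v ∈ A) : mix A e z v = z.2 (e v) := if_pos h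

lemma mix_of_notMem {A : Set (Grid d)} {e : Grid d → Grid d} {z : Labeling d × Labeling d}
    {v : Grid d} (h : v ∉ A) : mix A e z v = z.1 (e v) := if_neg h

/-- Reading each vertex of one labeling off a different vertex of one of two independent iid
labelings gives an iid labeling. -/
lemma measurePreserving_mix (A : Set (Grid d)) {e : Grid d → Grid d} (he : e.Injective) :
    MeasurePreserving (mix A e) ((iidMeasure d).prod (iidMeasure d)) (iidMeasure d) := by
  classical
  have hm : Measurable (mix A e : Labeling d × Labeling d → Labeling d) := by
    refine measurable_pi_lambda _ fun v => ?_
    by_cases hv : v ∈ A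
    · simp only [mix_of_mem hv]; fun_prop
    · simp only [mix_of_notMem hv]; fun_prop
  refine ⟨hm, ?_⟩
  let Q : Measure (Bool × Grid d → I) := Measure.infinitePi fun _ => volume
  have h1 : (iidMeasure d).prod (iidMeasure d) =
      Q.map (fun ω => ((fun v => ω (false, v)), (fun v => ω (true, v)))) := by
    have hc := Measure.infinitePi_map_curry (fun (_ : Bool) (_ : Grid d) => (volume : Measure I))
    have hp := Measure.infinitePi_map_eval_prod
      (P := fun _ : Bool => iidMeasure d) (i := false) (j := true) (by simp)
    rw [← hp]
    unfold iidMeasure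
    rw [← hc, Measure.map_map (by fun_prop) (by fun_prop)]
    rfl
  rw [h1, Measure.map_map hm (by fun_prop)]
  have := Measure.map_infinitePi_infinitePi_of_inj
    (P := fun _ : Bool × Grid d => (volume : Measure I))
    (f := fun v : Grid d => (decide (v ∈ A), e v)) (fun v w h => he (Prod.ext_iff.1 h).2)
  refine Eq.trans ?_ this
  congr 1
  funext ω v
  by_cases hv : v ∈ A <;> simp [mix, hv]

lemma measurePreserving_comp {e : Grid d → Grid d} (he : e.Injective) :
    MeasurePreserving (fun x : Labeling d => fun v => x (e v)) (iidMeasure d) (iidMeasure d) := by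
  refine ⟨by fun_prop, ?_⟩
  exact Measure.map_infinitePi_infinitePi_of_inj (P := fun _ : Grid d => (volume : Measure I)) he

lemma measurePreserving_shift (g : Grid d) :
    MeasurePreserving (shift g : Labeling d → Labeling d) (iidMeasure d) (iidMeasure d) :=
  measurePreserving_comp (add_right_injective g)

/-! ### The essential coding radius -/

/-- The labelings whose restriction to the ball of radius `r` almost surely determines the color of
the origin: resampling all labels outside the ball almost surely gives one and the same color.
Unlike the set where `DeterminedAt F x r` holds, this set is measurable. -/
def essDetermined (F : Labeling d → Grid d → Fin b) (r : ℕ) : Set (Labeling d) :=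
  {x | ∃ i, iidMeasure d {y | F (mix (ball d r)ᶜ id (x, y)) 0 = i} = 1}

variable {F : Labeling d → Grid d → Fin b}

lemma measurable_color (hF : Measurable F) (v : Grid d) : Measurable fun x => F x v := by
  fun_prop

lemma measurable_resample (hF : Measurable F) (r : ℕ) (i : Fin b) :
    Measurable fun x => iidMeasure d {y | F (mix (ball d r)ᶜ id (x, y)) 0 = i} := by
  have : MeasurableSet {z : Labeling d × Labeling d | F (mix (ball d r)ᶜ id z) 0 = i} :=
    (((measurable_color hF 0).comp (measurePreserving_mix _ Function.injective_id).measurable))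
      (measurableSet_singleton i)
  exact measurable_measure_prodMk_left this

lemma measurableSet_essDetermined (hF : Measurable F) (r : ℕ) :
    MeasurableSet (essDetermined F r) := by
  have : essDetermined F r =
      ⋃ i, {x | iidMeasure d {y | F (mix (ball d r)ᶜ id (x, y)) 0 = i} = 1} := by
    ext; simp [essDetermined]
  rw [this]
  exact .iUnion fun i => measurable_resample hF r i (measurableSet_singleton _)

lemma mix_congr_left {A : Set (Grid d)} {x x' y : Labeling d} (h : ∀ v ∉ A, x' v = x v) :
    mix A id (x', y) = mix A id (x, y) := by
  funext v
  by_cases hv : v ∈ A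
  · simp [mix, hv]
  · simp [mix, hv, h v hv]

/-- If resampling outside the ball almost surely gives the color `i`, then the labeling itself
almost surely gives the color `i`, since a partially resampled labeling is again iid. -/
lemma ae_eq_of_resample (hF : Measurable F) (r : ℕ) :
    ∀ᵐ x ∂iidMeasure d, ∀ i,
      iidMeasure d {y | F (mix (ball d r)ᶜ id (x, y)) 0 = i} = 1 → F x 0 = i := by
  rw [ae_all_iff]
  intro i
  have hM := measurePreserving_mix (d := d) (ball d r)ᶜ Function.injective_id
  set N : Set (Labeling d) :=
    {x | iidMeasure d {y | F (mix (ball d r)ᶜ id (x, y)) 0 = i} = 1 ∧ F x 0 ≠ i} with hN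
  have hNm : MeasurableSet N :=
    (measurable_resample hF r i (measurableSet_singleton _)).inter
      ((measurable_color hF 0) (measurableSet_singleton i)).compl
  have hz : iidMeasure d N = 0 := by
    rw [← hM.measure_preimage hNm.nullMeasurableSet, Measure.measure_prod_null (hM.measurable hNm)]
    refine Filter.Eventually.of_forall fun x => ?_
    have hcongr : ∀ y y', mix (ball d r)ᶜ id (mix (ball d r)ᶜ id (x, y), y') =
        mix (ball d r)ᶜ id (x, y') := fun y y' =>
      mix_congr_left fun v hv => by rw [mix_of_notMem hv]; rfl
    by_cases hx : iidMeasure d {y | F (mix (ball d r)ᶜ id (x, y)) 0 = i} = 1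
    · have hms : MeasurableSet {y | F (mix (ball d r)ᶜ id (x, y)) 0 = i} :=
        ((measurable_color hF 0).comp (hM.measurable.comp measurable_prodMk_left))
          (measurableSet_singleton i)
      refine measure_mono_null ?_ ((prob_compl_eq_zero_iff hms).2 hx)
      rintro y ⟨-, hy⟩
      exact hy
    · have : Prod.mk x ⁻¹' (mix (ball d r)ᶜ id ⁻¹' N) = ∅ := by
        ext y
        simp only [Set.mem_preimage, hN, Set.mem_ofPred_eq, hcongr, Set.mem_empty_iff_false,
          iff_false]
        exact fun h => hx h.1
      simp [this]
  rw [ae_iff]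
  convert hz using 2
  ext x
  simp [hN]

/-- The probability that the ball of radius `r` does not determine the color of the origin. -/
def undet (F : Labeling d → Grid d → Fin b) (r : ℕ) : ℝ≥0∞ := iidMeasure d (essDetermined F r)ᶜ

/-- Two iid labelings, on any probability space, that look the same around `v` and around `w` give
these vertices the same color, up to an event whose probability is governed by the coding radius.
The two labelings may depend on each other in any way. -/
lemma measure_color_ne_le {Ω : Type*} [MeasurableSpace Ω] {P : Measure Ω} (hF : IsFFIID F)
    {X Y : Ω → Labeling d} (hX : MeasurePreserving X P (iidMeasure d))
    (hY : MeasurePreserving Y P (iidMeasure d)) {v w : Grid d} {r : ℕ}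
    (h : ∀ ω, ∀ g ∈ ball d r, X ω (v + g) = Y ω (w + g)) :
    P {ω | F (X ω) v ≠ F (Y ω) w} ≤ undet F r := by
  have hXv := (measurePreserving_shift v).comp hX
  have hYw := (measurePreserving_shift w).comp hY
  have h1 := hXv.quasiMeasurePreserving.ae (ae_eq_of_resample hF.measurable r)
  have h2 := hYw.quasiMeasurePreserving.ae (ae_eq_of_resample hF.measurable r)
  have hm := measurableSet_essDetermined hF.measurable r
  rw [undet, ← hXv.measure_preimage hm.compl.nullMeasurableSet]
  refine measure_mono_ae ?_
  filter_upwards [h1, h2] with ω a1 a2 hω hin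
  obtain ⟨i, hi⟩ := hin
  have hag : ∀ u ∉ (ball d r)ᶜ, shift w (Y ω) u = shift v (X ω) u := fun u hu =>
    (h ω u (not_not.1 hu)).symm
  have e1 := a1 i hi
  have e2 := a2 i (by simpa only [Function.comp, mix_congr_left hag] using hi)
  simp only [Function.comp, hF.equivariant] at e1 e2
  simp only [shift, add_zero] at e1 e2
  exact hω (e1.trans e2.symm)

lemma ball_mono {r s : ℕ} (h : r ≤ s) : ball d r ⊆ ball d s := fun _ hv => le_trans hv h

lemma zero_mem_ball (r : ℕ) : (0 : Grid d) ∈ ball d r := by simp [ball]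

lemma DeterminedAt.mono {x : Labeling d} {r s : ℕ} (h : DeterminedAt F x r) (hrs : r ≤ s) :
    DeterminedAt F x s := fun x' hx' => h x' fun v hv => hx' v (ball_mono hrs hv)

lemma DeterminedAt.mem_essDetermined {x : Labeling d} {r : ℕ} (h : DeterminedAt F x r) :
    x ∈ essDetermined F r := by
  refine ⟨F x 0, ?_⟩
  have : {y | F (mix (ball d r)ᶜ id (x, y)) 0 = F x 0} = Set.univ :=
    Set.eq_univ_of_forall fun y => h _ fun v hv => by rw [mix_of_notMem (not_not.2 hv)]; rfl
  rw [this, measure_univ]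

lemma codingRadius_le {x : Labeling d} {r : ℕ} (h : DeterminedAt F x r) : codingRadius F x ≤ r :=
  iInf₂_le (f := fun (r : ℕ) (_ : DeterminedAt F x r) => (r : ℕ∞)) r h

lemma determinedAt_of_codingRadius_le {x : Labeling d} {r : ℕ} (h : codingRadius F x ≤ r) :
    DeterminedAt F x r := by
  by_contra hc
  have h1 : ((r + 1 : ℕ) : ℕ∞) ≤ codingRadius F x := by
    refine le_iInf₂ fun s hs => ?_
    have : r < s := by
      by_contra hsr
      exact hc (hs.mono (not_lt.1 hsr))
    exact_mod_cast this
  have := h1.trans h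
  norm_cast at this
  omega

/-- Where the coding radius is `n`, the balls of radius `i / 4` determine the color for all
`i ≥ 4 * n`. -/
lemma tsum_undet_le (hF : Measurable F) :
    ∑' i : ℕ, undet F (i / 4) ≤ 4 * codingMoment F 1 := by
  unfold codingMoment undet
  simp only [ENNReal.rpow_one]
  rw [← lintegral_const_mul' _ _ (by simp)]
  have h1 : ∀ i : ℕ, iidMeasure d (essDetermined F (i / 4))ᶜ =
      ∫⁻ x, (essDetermined F (i / 4))ᶜ.indicator 1 x ∂iidMeasure d := fun i =>
    (lintegral_indicator_one (measurableSet_essDetermined hF _).compl).symm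
  simp only [h1]
  rw [← lintegral_tsum fun i =>
    (measurable_one.indicator (measurableSet_essDetermined hF _).compl).aemeasurable]
  refine lintegral_mono fun x => ?_
  rcases eq_or_ne (codingRadius F x) ⊤ with hx | hx
  · simp [hx]
  · obtain ⟨n, hn⟩ := ENat.ne_top_iff_exists.1 hx
    have hdet : DeterminedAt F x n := determinedAt_of_codingRadius_le hn.symm.le
    rw [← hn]
    calc ∑' i : ℕ, (essDetermined F (i / 4))ᶜ.indicator 1 x
        = ∑ i ∈ Finset.range (4 * n),
            (essDetermined F (i / 4))ᶜ.indicator (1 : Labeling d → ℝ≥0∞) x := by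
          refine tsum_eq_sum fun i hi => ?_
          rw [Finset.mem_range, not_lt] at hi
          refine Set.indicator_of_notMem (not_not.2 ?_) _
          exact (hdet.mono (by omega)).mem_essDetermined
      _ ≤ ∑ i ∈ Finset.range (4 * n), 1 :=
          Finset.sum_le_sum fun i _ => Set.indicator_apply_le' (fun _ => le_rfl) (fun _ => zero_le)
      _ = 4 * ((n : ℕ∞) : ℝ≥0∞) := by simp

end

section

variable {d : ℕ}

/-! ### Heights of proper 3-colorings -/

lemma gridGraph_adj {v w : Grid d} :
    (gridGraph d).Adj v w ↔ ∃ i, w = v + Pi.single i 1 ∨ v = w + Pi.single i 1 := by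
  have hne : ∀ i : Fin d, (Pi.single i 1 : Grid d) ≠ 0 := fun i h => by
    have := congrFun h i
    simp at this
  simp only [gridGraph, SimpleGraph.fromRel_adj]
  constructor
  · rintro ⟨-, ⟨i, h⟩ | ⟨i, h⟩⟩
    exacts [⟨i, .inl h⟩, ⟨i, .inr h⟩]
  · rintro ⟨i, h | h⟩
    · exact ⟨fun e => hne i (by simp [e] at h), .inl ⟨i, h⟩⟩
    · exact ⟨fun e => hne i (by simp [e] at h), .inr ⟨i, h⟩⟩

lemma mem_ball_of_adj_zero {v : Grid d} (h : (gridGraph d).Adj 0 v) : v ∈ ball d 1 := by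
  obtain ⟨i, h | h⟩ := gridGraph_adj.1 h
  · rw [h, zero_add]
    simp [ball, Pi.single_apply, apply_ite Int.natAbs]
  · have : v = - Pi.single i 1 := (neg_eq_of_add_eq_zero_left h.symm).symm
    simp [this, ball, Pi.single_apply, apply_ite Int.natAbs]

lemma mem_solutions_properColoring {k : ℕ} {c : Grid d → Fin k} :
    c ∈ (properColoring d k).solutions ↔ ∀ v i, c v ≠ c (v + Pi.single i 1) := by
  constructor
  · intro h v i
    have hadj : (gridGraph d).Adj 0 (Pi.single i 1) := gridGraph_adj.2 ⟨i, .inl (by simp)⟩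
    have := h v ⟨0, zero_mem_ball 1⟩ ⟨_, mem_ball_of_adj_zero hadj⟩ rfl hadj
    simpa [shift] using this
  · intro h v u w hu hadj
    obtain ⟨u, hu'⟩ := u
    obtain ⟨w, hw'⟩ := w
    simp only at hu
    subst hu
    obtain ⟨i, hi | hi⟩ := gridGraph_adj.1 hadj
    · simp only at hi
      simpa [shift, hi] using h v i
    · simp only at hi
      have := h (v + w) i
      rw [add_assoc, ← hi] at this
      simpa [shift] using this.symm

/-- The increment of the height function of a proper `3`-coloring along an edge from color `a` to
color `b`: the representative `±1` of `b - a` modulo `3`. -/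
def inc (a b : Fin 3) : ℤ := if b = a + 1 then 1 else -1

lemma inc_eq_or (a b : Fin 3) : inc a b = 1 ∨ inc a b = -1 := by
  unfold inc; split_ifs <;> simp

/-- The height increments around a properly colored square sum up to zero. -/
lemma inc_square : ∀ a b c e : Fin 3, a ≠ b → b ≠ e → a ≠ c → c ≠ e →
    inc a b + inc b e = inc a c + inc c e := by decide

variable (i₀ i₁ : Fin d)

/-- The vertex with coordinates `(i, j)` in the plane spanned by the axes `i₀` and `i₁`. -/
def pt (i j : ℕ) : Grid d := Pi.single i₀ (i : ℤ) + Pi.single i₁ (j : ℤ)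

lemma pt_succ_left (i j : ℕ) : pt i₀ i₁ (i + 1) j = pt i₀ i₁ i j + Pi.single i₀ 1 := by
  simp only [pt, Nat.cast_add, Nat.cast_one, Pi.single_add]
  abel

lemma pt_succ_right (i j : ℕ) : pt i₀ i₁ i (j + 1) = pt i₀ i₁ i j + Pi.single i₁ 1 := by
  simp only [pt, Nat.cast_add, Nat.cast_one, Pi.single_add]
  abel

lemma pt_zero : pt i₀ i₁ 0 0 = 0 := by simp [pt]

lemma pt_apply_left (h : i₀ ≠ i₁) (i j : ℕ) : pt i₀ i₁ i j i₀ = i := by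
  simp [pt, h]

lemma pt_apply_right (h : i₀ ≠ i₁) (i j : ℕ) : pt i₀ i₁ i j i₁ = j := by
  simp [pt, h.symm]

lemma natAbs_add_natAbs_le (h : i₀ ≠ i₁) {g : Grid d} {r : ℕ} (hg : g ∈ ball d r) :
    (g i₀).natAbs + (g i₁).natAbs ≤ r := by
  refine le_trans ?_ hg
  rw [← Finset.sum_pair h (f := fun i => (g i).natAbs)]
  exact Finset.sum_le_sum_of_subset (Finset.subset_univ _)

/-- The height increment along row `j` from column `m` to column `n`. -/
def rowInc (c : Grid d → Fin 3) (j m n : ℕ) : ℤ :=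
  ∑ i ∈ Finset.Ico m n, inc (c (pt i₀ i₁ i j)) (c (pt i₀ i₁ (i + 1) j))

/-- The height increment along column `i` from row `0` to row `n`. -/
def colInc (c : Grid d → Fin 3) (i n : ℕ) : ℤ :=
  ∑ j ∈ Finset.range n, inc (c (pt i₀ i₁ i j)) (c (pt i₀ i₁ i (j + 1)))

variable {i₀ i₁}

lemma rowInc_add (c : Grid d → Fin 3) (j : ℕ) {l m n : ℕ} (h : l ≤ m) (h' : m ≤ n) :
    rowInc i₀ i₁ c j l m + rowInc i₀ i₁ c j m n = rowInc i₀ i₁ c j l n :=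
  Finset.sum_Ico_consecutive _ h h'

lemma rowInc_congr {c c' : Grid d → Fin 3} {j m n : ℕ} (s : ℕ)
    (h : ∀ i, m ≤ i → i ≤ n → c (pt i₀ i₁ i j) = c' (pt i₀ i₁ (i + s) j)) :
    rowInc i₀ i₁ c j m n = rowInc i₀ i₁ c' j (m + s) (n + s) := by
  unfold rowInc
  rw [← Finset.sum_Ico_add']
  refine Finset.sum_congr rfl fun i hi => ?_
  rw [Finset.mem_Ico] at hi
  rw [h i hi.1 hi.2.le, h (i + 1) (by omega) (by omega), Nat.add_right_comm]

lemma colInc_congr {c c' : Grid d → Fin 3} {i n : ℕ}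
    (h : ∀ j, j ≤ n → c (pt i₀ i₁ i j) = c' (pt i₀ i₁ i j)) :
    colInc i₀ i₁ c i n = colInc i₀ i₁ c' i n := by
  unfold colInc
  refine Finset.sum_congr rfl fun j hj => ?_
  rw [Finset.mem_range] at hj
  rw [h j hj.le, h (j + 1) (by omega)]

lemma abs_rowInc_le (c : Grid d → Fin 3) (j m n : ℕ) : |rowInc i₀ i₁ c j m n| ≤ (n - m : ℕ) := by
  refine (Finset.abs_sum_le_sum_abs _ _).trans ?_
  rw [Finset.sum_congr rfl (g := fun _ => (1 : ℤ))]
  · simp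
  · intro i _
    rcases inc_eq_or (c (pt i₀ i₁ i j)) (c (pt i₀ i₁ (i + 1) j)) with h | h <;> simp [h]

lemma even_rowInc_sub (c : Grid d → Fin 3) (j n : ℕ) : Even (rowInc i₀ i₁ c j 0 n - n) := by
  induction n with
  | zero => simp [rowInc]
  | succ n ih =>
    rw [← rowInc_add c j (Nat.zero_le n) n.le_succ]
    have : rowInc i₀ i₁ c j n (n + 1) = inc (c (pt i₀ i₁ n j)) (c (pt i₀ i₁ (n + 1) j)) := by
      simp [rowInc]
    rw [Nat.succ_eq_add_one, this]
    obtain ⟨k, hk⟩ := ih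
    rcases inc_eq_or (c (pt i₀ i₁ n j)) (c (pt i₀ i₁ (n + 1) j)) with h | h
    · exact ⟨k, by rw [h]; push_cast; linarith⟩
    · exact ⟨k - 1, by rw [h]; push_cast; linarith⟩

/-- The height increment between two vertices of a row does not change when the path along that row
is replaced by the detour along a parallel row. -/
lemma rowInc_add_colInc {c : Grid d → Fin 3} (hc : ∀ v i, c v ≠ c (v + Pi.single i 1)) (n J : ℕ) :
    rowInc i₀ i₁ c 0 0 n + colInc i₀ i₁ c n J = colInc i₀ i₁ c 0 J + rowInc i₀ i₁ c J 0 n := by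
  have step : ∀ j n, rowInc i₀ i₁ c j 0 n + inc (c (pt i₀ i₁ n j)) (c (pt i₀ i₁ n (j + 1))) =
      inc (c (pt i₀ i₁ 0 j)) (c (pt i₀ i₁ 0 (j + 1))) + rowInc i₀ i₁ c (j + 1) 0 n := by
    intro j n
    induction n with
    | zero => simp [rowInc]
    | succ n ih =>
      have hs := inc_square (c (pt i₀ i₁ n j)) (c (pt i₀ i₁ (n + 1) j)) (c (pt i₀ i₁ n (j + 1)))
        (c (pt i₀ i₁ (n + 1) (j + 1)))
        (by rw [pt_succ_left]; exact hc _ _) (by rw [pt_succ_right]; exact hc _ _)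
        (by rw [pt_succ_right]; exact hc _ _) (by rw [pt_succ_left]; exact hc _ _)
      simp only [rowInc, ← Finset.range_eq_Ico, Finset.sum_range_succ] at *
      linarith
  induction J with
  | zero => simp [colInc]
  | succ J ih =>
    have := step J n
    simp only [colInc, Finset.sum_range_succ] at *
    linarith

end

section

variable {d : ℕ}

/-! ### Height increments are determined near the endpoints -/

lemma mix_congr {A B : Set (Grid d)} {e : Grid d → Grid d} {z : Labeling d × Labeling d}
    {v : Grid d} (h : v ∈ A ↔ v ∈ B) : mix A e z v = mix B e z v := by
  by_cases hv : v ∈ A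
  · rw [mix_of_mem hv, mix_of_mem (h.1 hv)]
  · rw [mix_of_notMem hv, mix_of_notMem (mt h.2 hv)]

lemma mix_empty (e : Grid d → Grid d) (z : Labeling d × Labeling d) :
    mix ∅ e z = fun v => z.1 (e v) :=
  funext fun v => mix_of_notMem (Set.notMem_empty v)

lemma mix_univ (e : Grid d → Grid d) (z : Labeling d × Labeling d) :
    mix Set.univ e z = fun v => z.2 (e v) :=
  funext fun v => mix_of_mem (Set.mem_univ v)

/-- The union bound over finitely many vertices for `measure_color_ne_le`. -/
lemma measure_exists_color_ne_le {b : ℕ} {F : Labeling d → Grid d → Fin b} (hF : IsFFIID F)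
    {Ω : Type*} [MeasurableSpace Ω] {P : Measure Ω} {X Y : Ω → Labeling d}
    (hX : MeasurePreserving X P (iidMeasure d)) (hY : MeasurePreserving Y P (iidMeasure d))
    (s : Finset ℕ) (v w : ℕ → Grid d) (r : ℕ → ℕ)
    (h : ∀ ω, ∀ k ∈ s, ∀ g ∈ ball d (r k), X ω (v k + g) = Y ω (w k + g)) :
    P {ω | ∃ k ∈ s, F (X ω) (v k) ≠ F (Y ω) (w k)} ≤ ∑ k ∈ s, undet F (r k) := by
  have : {ω | ∃ k ∈ s, F (X ω) (v k) ≠ F (Y ω) (w k)} =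
      ⋃ k ∈ s, {ω | F (X ω) (v k) ≠ F (Y ω) (w k)} := by ext; simp
  rw [this]
  exact (measure_biUnion_finset_le _ _).trans <| Finset.sum_le_sum fun k hk =>
    measure_color_ne_le hF hX hY fun ω => h ω k hk

/-- Two squares of half side length `M` around the ends of the horizontal segment of length `n`
starting at the origin, extended in all directions perpendicular to the plane. -/
def endBox (i₀ i₁ : Fin d) (n M : ℕ) : Set (Grid d) :=
  {v | (v i₀).natAbs ≤ M ∧ (v i₁).natAbs ≤ M ∨ (v i₀ - n).natAbs ≤ M ∧ (v i₁).natAbs ≤ M}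

/-- The open diamond that has the horizontal segment of length `n` starting at the origin as a
diagonal, extended in all directions perpendicular to the plane. -/
def diamond (i₀ i₁ : Fin d) (n : ℕ) : Set (Grid d) :=
  {v | ((v i₁).natAbs : ℤ) < v i₀ ∧ ((v i₁).natAbs : ℤ) + v i₀ < n}

/-- The radius of the ball that is inspected at distance `i` from an endpoint of a path: a large
constant near the endpoint, and a fixed proportion of the distance far from it. -/
def coneRadius (K M i : ℕ) : ℕ := if i < K then M else i / 4

variable {i₀ i₁ : Fin d} {F : Labeling d → Grid d → Fin 3}

/-- Changing the labels away from two large boxes around the endpoints of a long segment most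
likely does not change the height increment along this segment: labels in the diamond around the
segment are resampled first, while the increment is read along a detour that avoids the diamond. -/
lemma measure_rowInc_mix_ne_le (h01 : i₀ ≠ i₁) (hF : IsFFIID F)
    (hs : ∀ᵐ x ∂iidMeasure d, ∀ v i, F x v ≠ F x (v + Pi.single i 1)) {δ : ℝ≥0∞}
    {K M : ℕ} (hK : 0 < K) (hKM : ∑' i, undet F (coneRadius K M i) ≤ δ)
    (hfar : ∀ (n m : ℕ), ∃ r, m ≤ r ∧ n * undet F r ≤ δ)
    {n : ℕ} {A B : Set (Grid d)} {e : Grid d → Grid d} (he : e.Injective)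
    (hAB : ∀ v ∈ endBox i₀ i₁ n (M + K), v ∈ A ↔ v ∈ B) :
    (iidMeasure d).prod (iidMeasure d)
      {z | rowInc i₀ i₁ (F (mix A e z)) 0 0 n ≠ rowInc i₀ i₁ (F (mix B e z)) 0 0 n} ≤ 5 * δ := by
  obtain ⟨r, hr, hrδ⟩ := hfar (n + 1) n
  set E := endBox i₀ i₁ n (M + K) with hE
  set L := diamond i₀ i₁ n with hL
  -- `A` on the ends and around the segment, `B` elsewhere
  set C : Set (Grid d) := {v | (v ∈ E ∪ L ∧ v ∈ A) ∨ (v ∉ E ∪ L ∧ v ∈ B)} with hC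
  have hAC : ∀ v ∈ E ∪ L, v ∈ A ↔ v ∈ C := fun v hv => by simp only [hC, Set.mem_ofPred_eq]; tauto
  have hCB : ∀ v, v ∈ E ∨ v ∉ L → (v ∈ C ↔ v ∈ B) := fun v hv => by
    by_cases hvE : v ∈ E
    · have := hAB v hvE
      simp only [hC, Set.mem_ofPred_eq, Set.mem_union]; tauto
    · simp only [hC, Set.mem_ofPred_eq, Set.mem_union]; tauto
  have mA := measurePreserving_mix A he
  have mB := measurePreserving_mix B he
  have mC := measurePreserving_mix C he
  have hl := pt_apply_left i₀ i₁ h01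
  have hri := pt_apply_right i₀ i₁ h01
  have hrow : ∑ k ∈ Finset.range (n + 1), undet F (coneRadius K M k) ≤ δ :=
    (ENNReal.sum_le_tsum _).trans hKM
  -- on the segment, the inspected balls lie in the ends and in the diamond, where `A` and `C` agree
  have bad1 := measure_exists_color_ne_le hF mA mC (Finset.range (n + 1))
    (fun k => pt i₀ i₁ k 0) (fun k => pt i₀ i₁ k 0)
    (fun k => if 2 * k ≤ n then coneRadius K M k else coneRadius K M (n - k))
    (fun z k hk g hg => mix_congr (hAC _ (by
      have hg' := natAbs_add_natAbs_le i₀ i₁ h01 hg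
      rw [Finset.mem_range] at hk
      simp only [coneRadius] at hg'
      simp only [hE, hL, endBox, diamond, Set.mem_union, Set.mem_ofPred_eq, Pi.add_apply, hl, hri]
      split_ifs at hg' <;> omega)))
  -- the detour climbs to row `4 * r`, follows it, and descends again; outside of the ends its balls
  -- miss the diamond, so that `C` and `B` agree on them
  have bad2 := measure_exists_color_ne_le hF mC mB (Finset.range (4 * r + 1))
    (fun k => pt i₀ i₁ 0 k) (fun k => pt i₀ i₁ 0 k) (coneRadius K M)
    (fun z k hk g hg => mix_congr (hCB _ (by
      have hg' := natAbs_add_natAbs_le i₀ i₁ h01 hg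
      simp only [coneRadius] at hg'
      simp only [hE, hL, endBox, diamond, Set.mem_ofPred_eq, Pi.add_apply, hl, hri]
      split_ifs at hg' <;> omega)))
  have bad3 := measure_exists_color_ne_le hF mC mB (Finset.range (4 * r + 1))
    (fun k => pt i₀ i₁ n k) (fun k => pt i₀ i₁ n k) (coneRadius K M)
    (fun z k hk g hg => mix_congr (hCB _ (by
      have hg' := natAbs_add_natAbs_le i₀ i₁ h01 hg
      simp only [coneRadius] at hg'
      simp only [hE, hL, endBox, diamond, Set.mem_ofPred_eq, Pi.add_apply, hl, hri]
      split_ifs at hg' <;> omega)))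
  have bad4 := measure_exists_color_ne_le hF mC mB (Finset.range (n + 1))
    (fun k => pt i₀ i₁ k (4 * r)) (fun k => pt i₀ i₁ k (4 * r)) (fun _ => r)
    (fun z k hk g hg => mix_congr (hCB _ (by
      have hg' := natAbs_add_natAbs_le i₀ i₁ h01 hg
      rw [Finset.mem_range] at hk
      simp only [hE, hL, endBox, diamond, Set.mem_ofPred_eq, Pi.add_apply, hl, hri]
      omega)))
  set b1 := {z | ∃ k ∈ Finset.range (n + 1), F (mix A e z) (pt i₀ i₁ k 0) ≠
    F (mix C e z) (pt i₀ i₁ k 0)}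
  set b2 := {z | ∃ k ∈ Finset.range (4 * r + 1), F (mix C e z) (pt i₀ i₁ 0 k) ≠
    F (mix B e z) (pt i₀ i₁ 0 k)}
  set b3 := {z | ∃ k ∈ Finset.range (4 * r + 1), F (mix C e z) (pt i₀ i₁ n k) ≠
    F (mix B e z) (pt i₀ i₁ n k)}
  set b4 := {z | ∃ k ∈ Finset.range (n + 1), F (mix C e z) (pt i₀ i₁ k (4 * r)) ≠
    F (mix B e z) (pt i₀ i₁ k (4 * r))}
  calc _ ≤ (iidMeasure d).prod (iidMeasure d) (b1 ∪ b2 ∪ b3 ∪ b4) := by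
        refine measure_mono_ae ?_
        filter_upwards [mB.quasiMeasurePreserving.ae hs, mC.quasiMeasurePreserving.ae hs]
          with z pB pC hz
        by_contra hb
        refine hz ?_
        change ¬ (z ∈ b1 ∪ b2 ∪ b3 ∪ b4) at hb
        simp only [Set.mem_union, not_or] at hb
        obtain ⟨⟨⟨n1, n2⟩, n3⟩, n4⟩ := hb
        simp only [b1, b2, b3, b4, Set.mem_ofPred_eq, not_exists, not_and, not_not,
          Finset.mem_range, Nat.lt_succ_iff] at n1 n2 n3 n4
        have e1 : rowInc i₀ i₁ (F (mix A e z)) 0 0 n = rowInc i₀ i₁ (F (mix C e z)) 0 0 n :=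
          rowInc_congr 0 fun i _ hi => n1 i hi
        have e2 := colInc_congr (i₀ := i₀) (i₁ := i₁) n2
        have e3 := colInc_congr (i₀ := i₀) (i₁ := i₁) n3
        have e4 : rowInc i₀ i₁ (F (mix C e z)) (4 * r) 0 n =
          rowInc i₀ i₁ (F (mix B e z)) (4 * r) 0 n := rowInc_congr 0 fun i _ hi => n4 i hi
        have q1 := rowInc_add_colInc (i₀ := i₀) (i₁ := i₁) pB n (4 * r)
        have q2 := rowInc_add_colInc (i₀ := i₀) (i₁ := i₁) pC n (4 * r)
        linarith
    _ ≤ (2 * δ) + δ + δ + δ := by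
        refine (measure_union_le _ _).trans (add_le_add ((measure_union_le _ _).trans (add_le_add
          ((measure_union_le _ _).trans (add_le_add ?_ ?_)) ?_)) ?_)
        · refine bad1.trans ?_
          calc _ ≤ ∑ k ∈ Finset.range (n + 1),
                (undet F (coneRadius K M k) + undet F (coneRadius K M (n - k))) := by
                refine Finset.sum_le_sum fun k _ => ?_
                split_ifs
                · exact le_self_add
                · exact le_add_self
            _ ≤ δ + δ := by
                rw [Finset.sum_add_distrib]
                refine add_le_add hrow ?_
                rwa [← Finset.sum_range_reflect] at hrow
            _ = 2 * δ := (two_mul δ).symm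
        · exact bad2.trans ((ENNReal.sum_le_tsum _).trans hKM)
        · exact bad3.trans ((ENNReal.sum_le_tsum _).trans hKM)
        · refine bad4.trans ?_
          rw [Finset.sum_const, Finset.card_range, nsmul_eq_mul]
          exact hrδ
    _ = 5 * δ := by ring

end

section

variable {d : ℕ}

/-! ### Deleting columns changes heights by a constant -/

/-- The embedding of the grid into itself that misses the `N` columns `m, …, m + N - 1` in
direction `i₀`. -/
def skip (i₀ : Fin d) (m N : ℕ) (v : Grid d) : Grid d :=
  if v i₀ < m then v else v + Pi.single i₀ (N : ℤ)

lemma skip_apply_same (i₀ : Fin d) (m N : ℕ) (v : Grid d) :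
    skip i₀ m N v i₀ = if v i₀ < m then v i₀ else v i₀ + N := by
  unfold skip; split_ifs <;> simp

lemma skip_apply_of_ne {i₀ i₁ : Fin d} (h : i₀ ≠ i₁) (m N : ℕ) (v : Grid d) :
    skip i₀ m N v i₁ = v i₁ := by
  unfold skip; split_ifs <;> simp [h]

lemma skip_injective (i₀ : Fin d) (m N : ℕ) : (skip i₀ m N).Injective := by
  intro v w h
  have h0 := congrFun h i₀
  rw [skip_apply_same, skip_apply_same] at h0
  unfold skip at h
  split_ifs at h h0
  · exact h
  · omega
  · omega
  · exact add_right_cancel h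

lemma skip_zero (i₀ : Fin d) (m : ℕ) (v : Grid d) : skip i₀ m 0 v = v := by
  simp [skip]

lemma skip_skip (i₀ : Fin d) (m N : ℕ) (v : Grid d) :
    skip i₀ m 1 (skip i₀ m N v) = skip i₀ m (N + 1) v := by
  by_cases h : v i₀ < m
  · simp [skip, h]
  · have : ¬ (v i₀ + (N : ℤ) < m) := by omega
    simp [skip, h, this, Pi.single_add, add_assoc]

/-- By how much the height increment along the horizontal segment of length `2 m + N` starting at
the origin changes when the `N` columns in its middle are deleted from the labeling. -/
def heightDrop (i₀ i₁ : Fin d) (F : Labeling d → Grid d → Fin 3) (m N : ℕ) (x : Labeling d) : ℤ :=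
  rowInc i₀ i₁ (F x) 0 0 (2 * m + N) - rowInc i₀ i₁ (F fun v => x (skip i₀ m N v)) 0 0 (2 * m)

variable {i₀ i₁ : Fin d} {F : Labeling d → Grid d → Fin 3}

lemma measurable_rowInc (hF : Measurable F) (j m n : ℕ) :
    Measurable fun x => rowInc i₀ i₁ (F x) j m n := by
  refine Finset.measurable_sum _ fun i _ => ?_
  exact (Measurable.of_discrete (f := fun p : Fin 3 × Fin 3 => inc p.1 p.2)).comp
    ((measurable_color hF _).prodMk (measurable_color hF _))

lemma measurable_heightDrop (hF : Measurable F) (m N : ℕ) :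
    Measurable (heightDrop i₀ i₁ F m N) :=
  (measurable_rowInc hF 0 _ _).sub
    ((measurable_rowInc hF 0 _ _).comp (measurePreserving_comp (skip_injective i₀ m N)).measurable)

/-- If two independent random variables are most likely equal, then each is most likely
constant. -/
lemma exists_measure_ne_le_of_prod {X α : Type*} [MeasurableSpace X] [MeasurableSpace α]
    [Countable α] [DiscreteMeasurableSpace α] {μ : Measure X} [IsProbabilityMeasure μ]
    {f g : X → α} (hf : Measurable f) (hg : Measurable g) {η : ℝ≥0∞}
    (h : (μ.prod μ) {z | f z.1 ≠ g z.2} ≤ η) : ∃ a, μ {x | f x ≠ a} ≤ η := by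
  have hm : MeasurableSet {z : X × X | f z.1 ≠ g z.2} :=
    (measurableSet_eq_fun (hf.comp measurable_fst) (hg.comp measurable_snd)).compl
  rw [Measure.prod_apply_symm hm] at h
  obtain ⟨y, hy⟩ := exists_le_lintegral (μ := μ)
    (measurable_measure_prodMk_right (μ := μ) hm).aemeasurable
  exact ⟨g y, hy.trans h⟩

lemma sum_undet_middle_le {b : ℕ} {G : Labeling d → Grid d → Fin b} {δ : ℝ≥0∞} {K n : ℕ}
    (hK : ∑' i, undet G ((i + K) / 4) ≤ δ) (hn : 2 * K ≤ n) :
    ∑ k ∈ Finset.Ico K (n - K + 1), undet G (if 2 * k ≤ n then k / 4 else (n - k) / 4) ≤ 2 * δ := by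
  have h1 : ∑ k ∈ Finset.Ico K (n - K + 1), undet G (k / 4) ≤ δ := by
    rw [Finset.sum_Ico_eq_sum_range]
    simp only [add_comm K]
    exact (ENNReal.sum_le_tsum _).trans hK
  have h2 : ∑ k ∈ Finset.Ico K (n - K + 1), undet G ((n - k) / 4) ≤ δ := by
    have := Finset.sum_Ico_reflect (fun j => undet G (j / 4)) K
      (m := n - K + 1) (n := n) (by omega)
    rw [this]
    rwa [show n + 1 - (n - K + 1) = K by omega, show n + 1 - K = n - K + 1 by omega]
  calc _ ≤ ∑ k ∈ Finset.Ico K (n - K + 1), (undet G (k / 4) + undet G ((n - k) / 4)) := by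
        refine Finset.sum_le_sum fun k _ => ?_
        split_ifs
        · exact le_self_add
        · exact le_add_self
    _ ≤ δ + δ := by rw [Finset.sum_add_distrib]; exact add_le_add h1 h2
    _ = 2 * δ := (two_mul δ).symm

/-- The height drop caused by the deletion of columns is most likely constant, with an error bound
that does not depend on the number of deleted columns. Two independent labelings are compared via
the first labeling with its ends replaced by those of the second one: replacing the ends
changes the increments before and after the deletion by the same amount, as the color pattern
near the ends is the same before and after; and once the ends are those of the second labeling,
the increments depend on nothing else. -/
lemma exists_measure_heightDrop_ne_le (h01 : i₀ ≠ i₁) (hF : IsFFIID F)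
    (hs : ∀ᵐ x ∂iidMeasure d, ∀ v i, F x v ≠ F x (v + Pi.single i 1)) {δ : ℝ≥0∞}
    {K M : ℕ} (hK : 0 < K) (hKM : ∑' i, undet F (coneRadius K M i) ≤ δ)
    (hfar : ∀ (n m : ℕ), ∃ r, m ≤ r ∧ n * undet F r ≤ δ)
    {K' M' m : ℕ} (hK' : ∑' i, undet F ((i + K') / 4) ≤ δ) (hKK : 2 * (M + K) + 4 ≤ K')
    (hM' : (K' + 1 : ℕ) * undet F M' ≤ δ) (hm : K' + M' + M + K + 1 ≤ m) (N : ℕ) :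
    ∃ a : ℤ, iidMeasure d {x | heightDrop i₀ i₁ F m N x ≠ a} ≤ 18 * δ := by
  have hl := pt_apply_left i₀ i₁ h01
  have hri := pt_apply_right i₀ i₁ h01
  have hsk := skip_injective i₀ m N
  set E := endBox i₀ i₁ (2 * m + N) (M + K) with hE
  set E' := skip i₀ m N ⁻¹' E with hE'
  -- once the ends are those of the second labeling, the rest may be replaced too
  have bad1 := measure_rowInc_mix_ne_le h01 hF hs hK hKM hfar (n := 2 * m + N) (A := E)
    (B := Set.univ) Function.injective_id (fun v hv => by simpa using hv)
  have bad2 := measure_rowInc_mix_ne_le h01 hF hs hK hKM hfar (n := 2 * m) (A := E')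
    (B := Set.univ) hsk (fun v hv => by
      simp only [hE', hE, endBox, Set.mem_preimage, Set.mem_ofPred_eq, skip_apply_same,
        skip_apply_of_ne h01, Set.mem_univ, iff_true] at hv ⊢
      push_cast at hv ⊢
      split_ifs <;> omega)
  have mA : ∀ A, MeasurePreserving (mix A id) ((iidMeasure d).prod (iidMeasure d)) (iidMeasure d) :=
    fun A => measurePreserving_mix A Function.injective_id
  have mS : ∀ A, MeasurePreserving (mix A (skip i₀ m N)) ((iidMeasure d).prod (iidMeasure d))
    (iidMeasure d) := fun A => measurePreserving_mix A hsk
  -- replacing the ends does not affect the colors far from them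
  have bad3 := measure_exists_color_ne_le hF (mA ∅) (mA E)
    (Finset.Ico K' (2 * m + N - K' + 1)) (fun k => pt i₀ i₁ k 0) (fun k => pt i₀ i₁ k 0)
    (fun k => if 2 * k ≤ 2 * m + N then k / 4 else (2 * m + N - k) / 4)
    (fun z k hk g hg => mix_congr (by
      have hg' := natAbs_add_natAbs_le i₀ i₁ h01 hg
      rw [Finset.mem_Ico] at hk
      simp only [hE, endBox, Set.mem_ofPred_eq, Pi.add_apply, hl, hri, Set.mem_empty_iff_false,
        false_iff]
      push_cast
      split_ifs at hg' <;> omega))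
  have bad4 := measure_exists_color_ne_le hF (mS ∅) (mS E')
    (Finset.Ico K' (2 * m - K' + 1)) (fun k => pt i₀ i₁ k 0) (fun k => pt i₀ i₁ k 0)
    (fun k => if 2 * k ≤ 2 * m then k / 4 else (2 * m - k) / 4)
    (fun z k hk g hg => mix_congr (by
      have hg' := natAbs_add_natAbs_le i₀ i₁ h01 hg
      rw [Finset.mem_Ico] at hk
      simp only [hE', hE, endBox, Set.mem_preimage, Set.mem_ofPred_eq, skip_apply_same,
        skip_apply_of_ne h01, Pi.add_apply, hl, hri, Set.mem_empty_iff_false, false_iff]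
      push_cast
      split_ifs at hg' ⊢ <;> omega))
  -- the colors near the two ends before and after the deletion
  have hleft : ∀ A z, ∀ k ∈ Finset.range (K' + 1), ∀ g ∈ ball d M',
      mix A id z (pt i₀ i₁ k 0 + g) =
        mix (skip i₀ m N ⁻¹' A) (skip i₀ m N) z (pt i₀ i₁ k 0 + g) := by
    intro A z k hk g hg
    have hg' := natAbs_add_natAbs_le i₀ i₁ h01 hg
    rw [Finset.mem_range] at hk
    have : skip i₀ m N (pt i₀ i₁ k 0 + g) = pt i₀ i₁ k 0 + g := by
      refine if_pos ?_
      rw [Pi.add_apply, hl]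
      omega
    conv_lhs => rw [← this]
    rfl
  have hright : ∀ A z, ∀ k ∈ Finset.range (K' + 1), ∀ g ∈ ball d M',
      mix A id z (pt i₀ i₁ (2 * m + N - K' + k) 0 + g) =
        mix (skip i₀ m N ⁻¹' A) (skip i₀ m N) z (pt i₀ i₁ (2 * m - K' + k) 0 + g) := by
    intro A z k hk g hg
    have hg' := natAbs_add_natAbs_le i₀ i₁ h01 hg
    rw [Finset.mem_range] at hk
    have : skip i₀ m N (pt i₀ i₁ (2 * m - K' + k) 0 + g) =
        pt i₀ i₁ (2 * m + N - K' + k) 0 + g := by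
      have e : 2 * m + N - K' + k = 2 * m - K' + k + N := by omega
      unfold skip
      rw [if_neg]
      · simp only [e, pt, Nat.cast_add, Pi.single_add]
        abel
      · rw [Pi.add_apply, hl]
        omega
    conv_lhs => rw [← this]
    rfl
  have bad5 := measure_exists_color_ne_le hF (mA ∅) (mS ∅) (Finset.range (K' + 1)) _ _ _ (hleft ∅)
  have bad6 := measure_exists_color_ne_le hF (mA ∅) (mS ∅) (Finset.range (K' + 1)) _ _ _ (hright ∅)
  have bad7 := measure_exists_color_ne_le hF (mA E) (mS E') (Finset.range (K' + 1)) _ _ _ (hleft E)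
  have bad8 := measure_exists_color_ne_le hF (mA E) (mS E') (Finset.range (K' + 1)) _ _ _ (hright E)
  have hend : ∑ k ∈ Finset.range (K' + 1), undet F M' ≤ δ := by
    rw [Finset.sum_const, Finset.card_range, nsmul_eq_mul]
    exact hM'
  have hmid := sum_undet_middle_le hK' (n := 2 * m + N) (by omega)
  have hmid' := sum_undet_middle_le hK' (n := 2 * m) (by omega)
  have u12 := (measure_union_le _ _).trans (add_le_add bad1 bad2)
  have u34 := (measure_union_le _ _).trans (add_le_add (bad3.trans hmid) (bad4.trans hmid'))
  have u56 := (measure_union_le _ _).trans (add_le_add (bad5.trans hend) (bad6.trans hend))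
  have u78 := (measure_union_le _ _).trans (add_le_add (bad7.trans hend) (bad8.trans hend))
  have u14 := (measure_union_le _ _).trans (add_le_add u12 u34)
  have u58 := (measure_union_le _ _).trans (add_le_add u56 u78)
  have u := (measure_union_le _ _).trans (add_le_add u14 u58)
  -- split both increments into the two ends and the middle: outside of the bad events, the
  -- contributions of the ends cancel in the height drop, and those of the middle are not affected
  refine exists_measure_ne_le_of_prod (g := heightDrop i₀ i₁ F m N)
    (measurable_heightDrop hF.measurable m N) (measurable_heightDrop hF.measurable m N) ?_
  refine (measure_mono fun z hz => ?_).trans (u.trans (le_of_eq (by ring)))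
  by_contra hb
  refine hz ?_
  simp only [Set.mem_union, not_or] at hb
  obtain ⟨⟨⟨n1, n2⟩, ⟨n3, n4⟩⟩, ⟨n5, n6⟩, ⟨n7, n8⟩⟩ := hb
  simp only [Set.mem_ofPred_eq, not_exists, not_and, not_not, Finset.mem_range, Finset.mem_Ico]
    at n1 n2 n3 n4 n5 n6 n7 n8
  have hz1 : heightDrop i₀ i₁ F m N z.1 = rowInc i₀ i₁ (F (mix ∅ id z)) 0 0 (2 * m + N) -
      rowInc i₀ i₁ (F (mix ∅ (skip i₀ m N) z)) 0 0 (2 * m) := by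
    rw [mix_empty, mix_empty]; rfl
  have hz2 : heightDrop i₀ i₁ F m N z.2 = rowInc i₀ i₁ (F (mix Set.univ id z)) 0 0 (2 * m + N) -
      rowInc i₀ i₁ (F (mix Set.univ (skip i₀ m N) z)) 0 0 (2 * m) := by
    rw [mix_univ, mix_univ]; rfl
  have split : ∀ c n, 2 * K' ≤ n → rowInc i₀ i₁ c 0 0 n = rowInc i₀ i₁ c 0 0 K' +
      rowInc i₀ i₁ c 0 K' (n - K') + rowInc i₀ i₁ c 0 (n - K') n := fun c n hn => by
    rw [rowInc_add c 0 (Nat.zero_le _) (by omega), rowInc_add c 0 (Nat.zero_le _) (by omega)]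
  have hlast : ∀ c c' : Grid d → Fin 3, (∀ k < K' + 1, c (pt i₀ i₁ (2 * m + N - K' + k) 0) =
      c' (pt i₀ i₁ (2 * m - K' + k) 0)) →
      rowInc i₀ i₁ c 0 (2 * m + N - K') (2 * m + N) =
      rowInc i₀ i₁ c' 0 (2 * m - K') (2 * m) := by
    intro c c' h
    have e1 : 2 * m + N - K' = 2 * m - K' + N := by omega
    rw [e1]
    refine (rowInc_congr N fun i h1 h2 => ?_).symm
    have := h (i - (2 * m - K')) (by omega)
    rw [e1, show 2 * m - K' + N + (i - (2 * m - K')) = i + N by omega,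
      show 2 * m - K' + (i - (2 * m - K')) = i by omega] at this
    exact this.symm
  have m3 := rowInc_congr (i₀ := i₀) (i₁ := i₁) (j := 0) 0
    fun i (h1 : K' ≤ i) (h2 : i ≤ 2 * m + N - K') => n3 i ⟨h1, by omega⟩
  have m4 := rowInc_congr (i₀ := i₀) (i₁ := i₁) (j := 0) 0
    fun i (h1 : K' ≤ i) (h2 : i ≤ 2 * m - K') => n4 i ⟨h1, by omega⟩
  have m5 := rowInc_congr (i₀ := i₀) (i₁ := i₁) (j := 0) 0
    fun i (_ : 0 ≤ i) (h2 : i ≤ K') => n5 i (by omega)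
  have m7 := rowInc_congr (i₀ := i₀) (i₁ := i₁) (j := 0) 0
    fun i (_ : 0 ≤ i) (h2 : i ≤ K') => n7 i (by omega)
  have m6 := hlast _ _ n6
  have m8 := hlast _ _ n8
  simp only [add_zero] at m3 m4 m5 m7
  rw [hz1, hz2, ← n1, ← n2, split _ (2 * m + N) (by omega), split _ (2 * m) (by omega),
    split (F (mix E id z)) (2 * m + N) (by omega),
    split (F (mix E' (skip i₀ m N) z)) (2 * m) (by omega)]
  linarith

end

section

variable {d : ℕ}

/-! ### The coding radius of a 3-coloring has infinite mean -/

lemma exists_notMem_of_measure_lt_one {X : Type*} [MeasurableSpace X] {μ : Measure X}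
    [IsProbabilityMeasure μ] {s : Set X} (h : μ s < 1) : ∃ x, x ∉ s := by
  by_contra! hc
  rw [Set.eq_univ_of_forall hc, measure_univ] at h
  exact h.false

variable {i₀ i₁ : Fin d} {F : Labeling d → Grid d → Fin 3}

lemma heightDrop_zero (m : ℕ) (x : Labeling d) : heightDrop i₀ i₁ F m 0 x = 0 := by
  simp [heightDrop, skip_zero]

lemma abs_heightDrop_le (m N : ℕ) (x : Labeling d) :
    |heightDrop i₀ i₁ F m N x| ≤ N + 4 * m := by
  have h1 := abs_rowInc_le (i₀ := i₀) (i₁ := i₁) (F x) 0 0 (2 * m + N)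
  have h2 := abs_rowInc_le (i₀ := i₀) (i₁ := i₁) (F fun v => x (skip i₀ m N v)) 0 0 (2 * m)
  unfold heightDrop
  rw [abs_le] at *
  rw [Nat.sub_zero] at h1 h2
  push_cast at *
  constructor <;> linarith

lemma odd_heightDrop_one (m : ℕ) (x : Labeling d) : Odd (heightDrop i₀ i₁ F m 1 x) := by
  obtain ⟨k, hk⟩ := even_rowInc_sub (i₀ := i₀) (i₁ := i₁) (F x) 0 (2 * m + 1)
  obtain ⟨l, hl⟩ := even_rowInc_sub (i₀ := i₀) (i₁ := i₁) (F fun v => x (skip i₀ m 1 v)) 0 (2 * m)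
  unfold heightDrop
  push_cast at *
  exact ⟨k - l, by linarith⟩

/-- The constant height drop is additive in the number of deleted columns. As it is odd for a single
column, and as the increment along `n` edges is at most `n`, it is `±1` per column. -/
lemma exists_slope (h01 : i₀ ≠ i₁) (hF : IsFFIID F) {δ : ℝ≥0∞} (hδ : 1000 * δ = 1) {K' m : ℕ}
    (hK' : ∀ k ≥ K', ∑' i, undet F ((i + k) / 4) ≤ δ) (hm : K' + 1 ≤ m)
    (ha : ∀ N : ℕ, ∃ a : ℤ, iidMeasure d {x | heightDrop i₀ i₁ F m N x ≠ a} ≤ 18 * δ) :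
    ∃ τ : ℤ, (τ = 1 ∨ τ = -1) ∧
      ∀ N : ℕ, iidMeasure d {x | heightDrop i₀ i₁ F m N x ≠ τ * N} ≤ 18 * δ := by
  have hl := pt_apply_left i₀ i₁ h01
  have hδt : δ ≠ ⊤ := by rintro rfl; simp at hδ
  have hlt : ∀ k : ℕ, k < 1000 → (k : ℝ≥0∞) * δ < 1 := by
    intro k hk
    have hδ0 : δ ≠ 0 := by rintro rfl; simp at hδ
    rw [← hδ]
    exact (ENNReal.mul_lt_mul_iff_left hδ0 hδt).2 (by exact_mod_cast hk)
  choose a ha using ha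
  have hex : ∀ N, ∃ x, heightDrop i₀ i₁ F m N x = a N := fun N => by
    obtain ⟨x, hx⟩ := exists_notMem_of_measure_lt_one ((ha N).trans_lt (hlt 18 (by norm_num)))
    exact ⟨x, not_not.1 hx⟩
  have h0 : a 0 = 0 := by
    obtain ⟨x, hx⟩ := hex 0
    rw [← hx, heightDrop_zero]
  -- deleting `N + 1` columns means deleting one column and then `N` more; to the right of the
  -- deleted column the colors are only translated
  have hrec : ∀ N, a (N + 1) = a N + a 1 := by
    intro N
    have mS := measurePreserving_comp (d := d) (skip_injective i₀ m 1)
    have hcmp := measure_exists_color_ne_le hF (MeasurePreserving.id (iidMeasure d)) mS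
      (Finset.range (N + 1)) (fun k => pt i₀ i₁ (2 * m + 1 + k) 0) (fun k => pt i₀ i₁ (2 * m + k) 0)
      (fun k => (k + 2 * m) / 4) (fun x k hk g hg => by
        have hg' := natAbs_add_natAbs_le i₀ i₁ h01 hg
        rw [Finset.mem_range] at hk
        have e : skip i₀ m 1 (pt i₀ i₁ (2 * m + k) 0 + g) = pt i₀ i₁ (2 * m + 1 + k) 0 + g := by
          unfold skip
          rw [if_neg]
          · simp only [pt, Nat.cast_add, Pi.single_add]
            abel
          · rw [Pi.add_apply, hl]
            omega
        rw [e, id])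
    have hsum : ∑ k ∈ Finset.range (N + 1), undet F ((k + 2 * m) / 4) ≤ δ :=
      (ENNReal.sum_le_tsum _).trans (hK' _ (by omega))
    have hN' := ha N
    have hNm : MeasurableSet {x | heightDrop i₀ i₁ F m N x ≠ a N} :=
      measurable_heightDrop hF.measurable m N (measurableSet_singleton (a N)).compl
    rw [← mS.measure_preimage hNm.nullMeasurableSet] at hN'
    have u := (measure_union_le _ _).trans (add_le_add
      ((measure_union_le _ _).trans (add_le_add (ha (N + 1)) hN'))
      ((measure_union_le _ _).trans (add_le_add (ha 1) (hcmp.trans hsum))))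
    obtain ⟨x, hx⟩ := exists_notMem_of_measure_lt_one (u.trans_lt
      (lt_of_eq_of_lt (by push_cast; ring) (hlt 55 (by norm_num))))
    simp only [Set.mem_union, not_or] at hx
    obtain ⟨⟨n1, n2⟩, n3, n4⟩ := hx
    simp only [Set.mem_ofPred_eq, Set.mem_preimage, not_exists, not_and, not_not, Finset.mem_range,
      id] at n1 n2 n3 n4
    have e : rowInc i₀ i₁ (F x) 0 (2 * m + 1) (2 * m + (N + 1)) =
        rowInc i₀ i₁ (F fun v => x (skip i₀ m 1 v)) 0 (2 * m) (2 * m + N) := by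
      rw [show 2 * m + (N + 1) = 2 * m + N + 1 by omega]
      refine (rowInc_congr 1 fun i h1 h2 => ?_).symm
      have := n4 (i - 2 * m) (by omega)
      rw [show 2 * m + 1 + (i - 2 * m) = i + 1 by omega, Nat.add_sub_cancel' h1] at this
      exact this.symm
    have s1 := rowInc_add (i₀ := i₀) (i₁ := i₁) (F x) 0 (Nat.zero_le (2 * m + 1))
      (show 2 * m + 1 ≤ 2 * m + (N + 1) by omega)
    have s2 := rowInc_add (i₀ := i₀) (i₁ := i₁) (F fun v => x (skip i₀ m 1 v)) 0
      (Nat.zero_le (2 * m)) (show 2 * m ≤ 2 * m + N by omega)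
    rw [← n1, ← n2, ← n3]
    simp only [heightDrop, skip_skip]
    linarith
  have hlin : ∀ N : ℕ, a N = a 1 * N := by
    intro N
    induction N with
    | zero => simp [h0]
    | succ N ih => rw [hrec, ih]; push_cast; ring
  have hodd : Odd (a 1) := by
    obtain ⟨x, hx⟩ := hex 1
    rw [← hx]
    exact odd_heightDrop_one m x
  -- `|a 1| * N ≤ N + 4 * m` for all `N`, in particular for `N = 4 * m + 1`
  have hle : |a 1| ≤ 1 := by
    obtain ⟨x, hx⟩ := hex (4 * m + 1)
    have h1 := abs_heightDrop_le (i₀ := i₀) (i₁ := i₁) (F := F) m (4 * m + 1) x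
    rw [hx, hlin, abs_mul] at h1
    push_cast at h1
    rw [abs_of_nonneg (by positivity : (0 : ℤ) ≤ 4 * m + 1)] at h1
    by_contra hc
    have : 2 ≤ |a 1| := by omega
    nlinarith
  refine ⟨a 1, ?_, fun N => ?_⟩
  · obtain ⟨k, hk⟩ := hodd
    rw [abs_le] at hle
    omega
  · rw [← hlin]
    exact ha N

/-- If the height drop is `±1` per deleted column, then almost all steps of a long segment go in the
same direction. -/
lemma measure_exists_inc_ne_le (hF : IsFFIID F) {δ : ℝ≥0∞} (hδ : 1000 * δ = 1)
    {m : ℕ} {τ : ℤ} (hτ : τ = 1 ∨ τ = -1)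
    (h : ∀ N : ℕ, iidMeasure d {x | heightDrop i₀ i₁ F m N x ≠ τ * N} ≤ 18 * δ)
    {L : ℕ} (hL : 0 < L) :
    iidMeasure d {x | ∃ i < L, inc (F x (pt i₀ i₁ i 0)) (F x (pt i₀ i₁ (i + 1) 0)) ≠ τ} ≤
      19 * δ := by
  classical
  set B : ℕ → Set (Labeling d) := fun w => {x | ∃ i < L,
    inc (F x (pt i₀ i₁ (w * L + i) 0)) (F x (pt i₀ i₁ (w * L + i + 1) 0)) ≠ τ} with hB
  have hBm : ∀ w, MeasurableSet (B w) := by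
    intro w
    have : B w = ⋃ i ∈ Finset.range L, {x |
        inc (F x (pt i₀ i₁ (w * L + i) 0)) (F x (pt i₀ i₁ (w * L + i + 1) 0)) ≠ τ} := by
      ext; simp [hB]
    rw [this]
    refine Finset.measurableSet_biUnion _ fun i _ => ?_
    exact ((Measurable.of_discrete (f := fun p : Fin 3 × Fin 3 => inc p.1 p.2)).comp
      ((measurable_color hF.measurable (pt i₀ i₁ (w * L + i) 0)).prodMk
        (measurable_color hF.measurable (pt i₀ i₁ (w * L + i + 1) 0))))
      (measurableSet_singleton τ).compl
  have hstat : ∀ w, iidMeasure d (B w) = iidMeasure d (B 0) := by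
    intro w
    rw [← (measurePreserving_shift (pt i₀ i₁ (w * L) 0)).measure_preimage (hBm 0).nullMeasurableSet]
    congr 1
    have e : ∀ i, pt i₀ i₁ (w * L) 0 + pt i₀ i₁ i 0 = pt i₀ i₁ (w * L + i) 0 := fun i => by
      simp [pt, Pi.single_add]
    ext x
    simp only [hB, Set.mem_preimage, Set.mem_ofPred_eq, hF.equivariant, zero_mul, zero_add]
    simp only [shift, e, add_assoc]
  -- among `W` windows of length `L`, a set of `2 * m` windows has a density of at most `δ`
  set W := 1000 * (2 * m) + 1 with hW
  obtain ⟨N, hN⟩ : ∃ N, W * L = 2 * m + N := Nat.exists_eq_add_of_le (by nlinarith)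
  set G : Set (Labeling d) := {x | heightDrop i₀ i₁ F m N x ≠ τ * N} with hG
  have hGm : MeasurableSet G :=
    (measurable_heightDrop hF.measurable m N) (measurableSet_singleton _).compl
  -- outside `G` there are at most `2 m` bad steps, hence at most so many bad windows
  have hpt : ∀ x, ∑ w ∈ Finset.range W, (B w).indicator (1 : Labeling d → ℝ≥0∞) x ≤
      (2 * m : ℕ) + W * G.indicator (1 : Labeling d → ℝ≥0∞) x := by
    intro x
    by_cases hx : x ∈ G
    · rw [Set.indicator_of_mem hx, Pi.one_apply, mul_one]
      refine le_trans ?_ le_add_self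
      calc ∑ w ∈ Finset.range W, (B w).indicator (1 : Labeling d → ℝ≥0∞) x
          ≤ ∑ w ∈ Finset.range W, (1 : ℝ≥0∞) :=
            Finset.sum_le_sum fun w _ =>
              Set.indicator_apply_le' (fun _ => le_rfl) (fun _ => zero_le)
        _ = W := by simp
    · rw [Set.indicator_of_notMem hx, mul_zero, add_zero]
      replace hx : heightDrop i₀ i₁ F m N x = τ * N := not_not.1 hx
      set s : ℕ → ℤ := fun i => inc (F x (pt i₀ i₁ i 0)) (F x (pt i₀ i₁ (i + 1) 0)) with hs
      set bad := (Finset.range (W * L)).filter fun i => s i ≠ τ with hbad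
      have hcount : bad.card ≤ 2 * m := by
        have h1 : ∀ i, τ * s i = 1 - 2 * (if s i ≠ τ then 1 else 0) := by
          intro i
          rcases inc_eq_or (F x (pt i₀ i₁ i 0)) (F x (pt i₀ i₁ (i + 1) 0)) with e | e <;>
            rcases hτ with e' | e' <;> simp [hs, e, e']
        have h2 : τ * rowInc i₀ i₁ (F x) 0 0 (W * L) = W * L - 2 * bad.card := by
          unfold rowInc
          rw [Finset.mul_sum, ← Finset.range_eq_Ico, Finset.sum_congr rfl fun i _ => h1 i,
            Finset.sum_sub_distrib, ← Finset.mul_sum, hbad, Finset.card_filter]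
          simp
        have h3 := abs_rowInc_le (i₀ := i₀) (i₁ := i₁) (F fun v => x (skip i₀ m N v)) 0 0 (2 * m)
        unfold heightDrop at hx
        rw [← hN] at hx
        have hN' : (W : ℤ) * L = 2 * m + N := by exact_mod_cast hN
        rw [abs_le, Nat.sub_zero] at h3
        push_cast at h3
        zify
        rcases hτ with e | e <;> rw [e] at h2 hx <;> linarith
      have himg : (Finset.range W).filter (fun w => x ∈ B w) ⊆ bad.image (· / L) := by
        intro w hw
        rw [Finset.mem_filter, Finset.mem_range] at hw
        obtain ⟨hw, i, hi, hne⟩ := hw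
        refine Finset.mem_image.2 ⟨w * L + i, Finset.mem_filter.2 ⟨?_, hne⟩, ?_⟩
        · rw [Finset.mem_range]
          nlinarith
        · rw [mul_comm, Nat.mul_add_div hL, Nat.div_eq_of_lt hi, add_zero]
      have hcard := (Finset.card_le_card himg).trans (Finset.card_image_le.trans hcount)
      calc ∑ w ∈ Finset.range W, (B w).indicator (1 : Labeling d → ℝ≥0∞) x
          = ((Finset.range W).filter fun w => x ∈ B w).card := by
            rw [Finset.card_filter, Nat.cast_sum]
            exact Finset.sum_congr rfl fun w _ => by by_cases hw : x ∈ B w <;> simp [hw]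
        _ ≤ (2 * m : ℕ) := by exact_mod_cast hcard
  have hint : (W : ℝ≥0∞) * iidMeasure d (B 0) ≤ W * (19 * δ) := by
    have h1 := lintegral_mono (μ := iidMeasure d) hpt
    rw [lintegral_finsetSum _ fun w _ => measurable_one.indicator (hBm w), lintegral_add_right _
      ((measurable_one.indicator hGm).const_mul _), lintegral_const_mul _
      (measurable_one.indicator hGm)] at h1
    simp only [lintegral_indicator_one (hBm _), lintegral_indicator_one hGm, hstat,
      lintegral_const, measure_univ, mul_one, Finset.sum_const, Finset.card_range,
      nsmul_eq_mul] at h1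
    refine h1.trans ?_
    have h2 : ((2 * m : ℕ) : ℝ≥0∞) ≤ W * δ := by
      calc ((2 * m : ℕ) : ℝ≥0∞) = (2 * m : ℕ) * (1000 * δ) := by rw [hδ, mul_one]
        _ = ((1000 * (2 * m) : ℕ) : ℝ≥0∞) * δ := by push_cast; ring
        _ ≤ W * δ := by gcongr; omega
    calc _ ≤ W * δ + W * (18 * δ) := add_le_add h2 (by gcongr; exact h N)
      _ = W * (19 * δ) := by ring
  have hW0 : (W : ℝ≥0∞) ≠ 0 := by simp [hW]
  have := (ENNReal.mul_le_mul_iff_right hW0 (ENNReal.natCast_ne_top W)).1 hint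
  simpa [hB] using this

end

section

variable {d : ℕ} {i₀ i₁ : Fin d} {F : Labeling d → Grid d → Fin 3}

lemma add_three_mul_nsmul (c : ℕ → Fin 3) (t : Fin 3) {k : ℕ}
    (h : ∀ i < 3 * k, c (i + 1) = c i + t) : c (3 * k) = c 0 := by
  induction k with
  | zero => rfl
  | succ k ih =>
    rw [show 3 * (k + 1) = 3 * k + 1 + 1 + 1 by ring, h (3 * k + 1 + 1) (by omega),
      h (3 * k + 1) (by omega), h (3 * k) (by omega), ih fun i hi => h i (by omega)]
    have key : ∀ a t : Fin 3, a + t + t + t = a := by decide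
    exact key _ _

/-- If most long segments are monotone in height, then the color of the origin is most likely
constant: along a monotone segment whose length is a multiple of `3`, the colors at the ends agree,
while they are almost independent. This contradicts properness. -/
lemma false_of_measure_exists_inc_ne_le (h01 : i₀ ≠ i₁) (hF : IsFFIID F)
    (hs : ∀ᵐ x ∂iidMeasure d, ∀ v i, F x v ≠ F x (v + Pi.single i 1)) {δ : ℝ≥0∞}
    (hδ : 1000 * δ = 1) {τ : ℤ} {r : ℕ} (hr : undet F r ≤ δ)
    (h : ∀ L : ℕ, 0 < L → iidMeasure d {x | ∃ i < L,
      inc (F x (pt i₀ i₁ i 0)) (F x (pt i₀ i₁ (i + 1) 0)) ≠ τ} ≤ 19 * δ) : False := by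
  have hl := pt_apply_left i₀ i₁ h01
  set L := 3 * (2 * r + 2) with hL
  have hmono : ∀ x, (∀ v i, F x v ≠ F x (v + Pi.single i 1)) →
      (¬ ∃ i < L, inc (F x (pt i₀ i₁ i 0)) (F x (pt i₀ i₁ (i + 1) 0)) ≠ τ) →
      F x (pt i₀ i₁ L 0) = F x (pt i₀ i₁ 0 0) := by
    intro x hp hx
    push Not at hx
    refine add_three_mul_nsmul (fun i => F x (pt i₀ i₁ i 0)) (if τ = 1 then 1 else 2)
      fun i hi => ?_
    have h1 := hx i hi
    have h2 : F x (pt i₀ i₁ i 0) ≠ F x (pt i₀ i₁ (i + 1) 0) := by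
      rw [pt_succ_left]
      exact hp _ _
    rw [← h1]
    revert h2
    generalize F x (pt i₀ i₁ i 0) = a
    generalize F x (pt i₀ i₁ (i + 1) 0) = b
    revert a b
    decide
  -- the labels around the origin and around the other end come from independent labelings
  set A : Set (Grid d) := {v | (r : ℤ) < v i₀} with hA
  have mA := measurePreserving_mix A Function.injective_id
  have m0 := measurePreserving_mix (∅ : Set (Grid d)) Function.injective_id
  have m1 := measurePreserving_mix (Set.univ : Set (Grid d)) Function.injective_id
  have bad1 := (measure_color_ne_le hF m0 mA (v := pt i₀ i₁ 0 0) (w := pt i₀ i₁ 0 0) (r := r)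
    fun z g hg => mix_congr (by
      have hg' := natAbs_add_natAbs_le i₀ i₁ h01 hg
      simp only [hA, Set.mem_ofPred_eq, Pi.add_apply, hl, Set.mem_empty_iff_false, false_iff]
      omega)).trans hr
  have bad2 := (measure_color_ne_le hF mA m1 (v := pt i₀ i₁ L 0) (w := pt i₀ i₁ L 0) (r := r)
    fun z g hg => mix_congr (by
      have hg' := natAbs_add_natAbs_le i₀ i₁ h01 hg
      simp only [hA, Set.mem_ofPred_eq, Pi.add_apply, hl, Set.mem_univ, iff_true]
      omega)).trans hr
  have bad3 : (iidMeasure d).prod (iidMeasure d) {z | ∃ i < L, inc (F (mix A id z) (pt i₀ i₁ i 0))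
      (F (mix A id z) (pt i₀ i₁ (i + 1) 0)) ≠ τ} ≤ 19 * δ :=
    (mA.measure_preimage_le {x | ∃ i < L,
      inc (F x (pt i₀ i₁ i 0)) (F x (pt i₀ i₁ (i + 1) 0)) ≠ τ}).trans (h L (by omega))
  have u := (measure_union_le _ _).trans (add_le_add ((measure_union_le _ _).trans
    (add_le_add bad1 bad2)) ((measure_union_le _ _).trans
    (add_le_add bad3 (ae_iff.1 (mA.quasiMeasurePreserving.ae hs)).le)))
  obtain ⟨c, hc⟩ := exists_measure_ne_le_of_prod (μ := iidMeasure d) (f := fun x => F x 0)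
    (g := fun x => F x (pt i₀ i₁ L 0)) (measurable_color hF.measurable _)
    (measurable_color hF.measurable _) (η := 21 * δ) (by
      refine (measure_mono fun z hz => ?_).trans (u.trans (le_of_eq (by ring)))
      by_contra hb
      simp only [Set.mem_union, not_or] at hb
      obtain ⟨⟨n1, n2⟩, n3, hp⟩ := hb
      simp only [Set.mem_ofPred_eq, ne_eq, not_not] at n1 n2
      have := hmono _ (not_not.1 hp) n3
      rw [mix_empty] at n1
      rw [mix_univ] at n2
      refine hz ?_
      rw [pt_zero] at n1 this
      exact n1.trans (this.symm.trans n2))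
  have hcm : MeasurableSet {x | F x 0 ≠ c} :=
    (measurable_color hF.measurable 0) (measurableSet_singleton c).compl
  have hc' := hc
  rw [← (measurePreserving_shift (Pi.single i₀ 1)).measure_preimage hcm.nullMeasurableSet] at hc'
  have u' := (measure_union_le _ _).trans (add_le_add ((measure_union_le _ _).trans
    (add_le_add hc hc')) (ae_iff.1 hs).le)
  have hlt : 42 * δ < 1 := by
    have hδ0 : δ ≠ 0 := by rintro rfl; simp at hδ
    have hδt : δ ≠ ⊤ := by rintro rfl; simp at hδ
    rw [← hδ]
    exact (ENNReal.mul_lt_mul_iff_left hδ0 hδt).2 (by norm_num)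
  obtain ⟨x, hx⟩ := exists_notMem_of_measure_lt_one (u'.trans_lt
    (lt_of_eq_of_lt (by ring) hlt))
  simp only [Set.mem_union, not_or] at hx
  obtain ⟨⟨n1, n2⟩, n3⟩ := hx
  simp only [Set.mem_ofPred_eq, Set.mem_preimage, ne_eq, not_not] at n1 n2 n3
  refine n3 0 i₀ ?_
  rw [n1, ← n2, hF.equivariant]
  simp [shift]

/-- A finitary factor of iid that is a proper `3`-coloring has a coding radius of infinite mean. -/
theorem codingMoment_one_eq_top (hd : 1 < d)
    (hF : IsFFIIDSolution (properColoring d 3) F) : codingMoment F 1 = ⊤ := by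
  by_contra hne
  obtain ⟨hF, hsol⟩ := hF
  have hs : ∀ᵐ x ∂iidMeasure d, ∀ v i, F x v ≠ F x (v + Pi.single i 1) := by
    filter_upwards [hsol] with x hx using mem_solutions_properColoring.1 hx
  have h01 : (⟨0, by omega⟩ : Fin d) ≠ ⟨1, hd⟩ := by simp
  obtain ⟨δ, hδ⟩ : ∃ δ : ℝ≥0∞, 1000 * δ = 1 := ⟨1000⁻¹, ENNReal.mul_inv_cancel (by simp) (by simp)⟩
  have hδ0 : 0 < δ := pos_iff_ne_zero.2 (by rintro rfl; simp at hδ)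
  have hsum : ∑' i : ℕ, undet F (i / 4) ≠ ⊤ := ne_top_of_le_ne_top
    (ENNReal.mul_ne_top (by simp) hne) (tsum_undet_le hF.measurable)
  have htail : ∀ η : ℝ≥0∞, 0 < η → ∃ K, ∀ k ≥ K, ∑' i, undet F ((i + k) / 4) ≤ η := by
    intro η hη
    have := (ENNReal.tendsto_sum_nat_add _ hsum).eventually (ge_mem_nhds hη)
    exact Filter.eventually_atTop.1 this
  have hsmall : ∀ η : ℝ≥0∞, 0 < η → ∃ r, ∀ s ≥ r, undet F s ≤ η := by
    intro η hη
    obtain ⟨K, hK⟩ := htail η hη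
    refine ⟨K, fun s hs => ?_⟩
    have := (ENNReal.le_tsum 0).trans (hK (4 * s) (by omega))
    simpa using this
  have hfar : ∀ n m : ℕ, ∃ r, m ≤ r ∧ n * undet F r ≤ δ := by
    intro n m
    obtain ⟨r, hr⟩ := hsmall (δ / n) (ENNReal.div_pos hδ0.ne' (by simp))
    exact ⟨max m r, le_max_left _ _, (mul_le_mul_right (hr _ (le_max_right _ _)) _).trans
      ENNReal.mul_div_le⟩
  obtain ⟨K, hK⟩ := htail (δ / 2) (ENNReal.half_pos hδ0.ne')
  obtain ⟨M, hM⟩ : ∃ M, (K + 1 : ℕ) * undet F M ≤ δ / 2 := by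
    obtain ⟨r, hr⟩ := hsmall (δ / 2 / (K + 1 : ℕ))
      (ENNReal.div_pos (ENNReal.half_pos hδ0.ne').ne' (by simp))
    exact ⟨r, (mul_le_mul_right (hr r le_rfl) _).trans ENNReal.mul_div_le⟩
  have hKM : ∑' i, undet F (coneRadius (K + 1) M i) ≤ δ := by
    have hnear : ∑ i ∈ Finset.range (K + 1), undet F (coneRadius (K + 1) M i) ≤ δ / 2 := by
      refine le_trans (le_of_eq ?_) hM
      rw [← nsmul_eq_mul, ← Finset.card_range (K + 1), ← Finset.sum_const, Finset.card_range]
      exact Finset.sum_congr rfl fun i hi => by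
        rw [coneRadius, if_pos (Finset.mem_range.1 hi)]
    have hrest : ∑' i, undet F (coneRadius (K + 1) M (i + (K + 1))) ≤ δ / 2 := by
      have : ∀ i, coneRadius (K + 1) M (i + (K + 1)) = (i + (K + 1)) / 4 := fun i =>
        if_neg (by omega)
      simp only [this]
      exact hK _ (Nat.le_succ _)
    have hsplit := Summable.sum_add_tsum_nat_add'
      (f := fun i => undet F (coneRadius (K + 1) M i)) (k := K + 1) ENNReal.summable
    calc _ = _ := hsplit.symm
      _ ≤ δ / 2 + δ / 2 := add_le_add hnear hrest
      _ = δ := ENNReal.add_halves δ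
  obtain ⟨K₀, hK₀⟩ := htail δ hδ0
  set K' := max K₀ (2 * (M + (K + 1)) + 4)
  obtain ⟨M', -, hM'⟩ := hfar (K' + 1) 0
  have ha := exists_measure_heightDrop_ne_le h01 hF hs K.succ_pos hKM hfar
    (hK₀ K' (le_max_left _ _)) (le_max_right _ _) hM' le_rfl
  obtain ⟨τ, hτ, hτ'⟩ := exists_slope h01 hF hδ (K' := K')
    (fun k hk => hK₀ k ((le_max_left _ _).trans hk)) (by omega) ha
  obtain ⟨r, hr⟩ := hsmall δ hδ0
  exact false_of_measure_exists_inc_ne_le h01 hF hs hδ (hr r le_rfl)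
    fun L hL => measure_exists_inc_ne_le hF hδ hτ hτ' hL

end

section

variable {d : ℕ}

/-! ### A hierarchy of clusters -/

/-- The `ℓ^∞`-distance of two vertices. -/
def supDist (x y : Grid d) : ℕ := Finset.univ.sup fun i => (x i - y i).natAbs

lemma supDist_le {x y : Grid d} {n : ℕ} : supDist x y ≤ n ↔ ∀ i, (x i - y i).natAbs ≤ n := by
  simp [supDist]

lemma natAbs_sub_le_supDist (x y : Grid d) (i : Fin d) : (x i - y i).natAbs ≤ supDist x y :=
  supDist_le.1 le_rfl i

lemma supDist_self (x : Grid d) : supDist x x = 0 :=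
  Nat.le_zero.1 (supDist_le.2 fun i => by simp)

lemma supDist_comm (x y : Grid d) : supDist x y = supDist y x := by
  unfold supDist
  congr 1
  funext i
  omega

lemma supDist_triangle (x y z : Grid d) : supDist x z ≤ supDist x y + supDist y z := by
  refine supDist_le.2 fun i => ?_
  have h1 := natAbs_sub_le_supDist x y i
  have h2 := natAbs_sub_le_supDist y z i
  omega

lemma supDist_add_left (g x y : Grid d) : supDist (g + x) (g + y) = supDist x y := by
  simp [supDist]

/-- The length scales of the construction: `reach k` bounds the diameter of what is built from the
clusters of scale less than `k`. -/
def reach : ℕ → ℕ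
  | 0 => 2
  | k + 1 => 4 * (reach k + 2 ^ (k + 2) * reach k)

/-- The boxes of scale `k` have a radius between `boxRadius k` and `2 * boxRadius k`. -/
def boxRadius (k : ℕ) : ℕ := 2 ^ (k + 2) * reach k

lemma reach_succ (k : ℕ) : reach (k + 1) = 4 * (reach k + boxRadius k) := rfl

lemma two_le_reach (k : ℕ) : 2 ≤ reach k := by
  induction k with
  | zero => rfl
  | succ k ih => rw [reach_succ]; omega

/-- Label fields: the label `ω k u` of the vertex `u` at scale `k` is the radius of a random box
around `u`, with `0` for no box. -/
abbrev Field (d : ℕ) : Type := ℕ → Grid d → ℕ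

/-- The radius of the box of scale `k` around `u`, truncated so that it is bounded surely. -/
def truncRadius (ω : Field d) (k : ℕ) (u : Grid d) : ℕ := min (ω k u) (2 * boxRadius k)

/-- The centers of the boxes of scale `k` that contain `x`. -/
def centers (ω : Field d) (k : ℕ) (x : Grid d) : Set (Grid d) :=
  {u | supDist x u < truncRadius ω k u}

/-- The vertices that lie in some box of scale `k` and are not close to the boundary of any box of
scale `k`. -/
def core (ω : Field d) (k : ℕ) : Set (Grid d) :=
  {x | (centers ω k x).Nonempty ∧ ∀ y, supDist x y ≤ 4 * reach k → centers ω k y = centers ω k x}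

/-- A step from `x` to `y` via a vertex of `W` that is at distance at most `3` from both. -/
def Step (W : Set (Grid d)) (x y : Grid d) : Prop := ∃ v ∈ W, supDist x v ≤ 3 ∧ supDist v y ≤ 3

/-- The smallest superset of `U` that contains the `3`-neighborhood of every vertex of `W` at
distance at most `3` from it. -/
def hull (W U : Set (Grid d)) : Set (Grid d) := {y | ∃ x ∈ U, Relation.ReflTransGen (Step W) x y}

/-- The vertices that belong to a cluster of scale less than `k`. -/
def covered (ω : Field d) : ℕ → Set (Grid d)
  | 0 => ∅
  | k + 1 => covered ω k ∪ hull (covered ω k) (core ω k)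

/-- The clusters of scale `k`: the core, enlarged so that the `3`-neighborhood of each vertex of
smaller scale close to them is contained in them. -/
def cluster (ω : Field d) (k : ℕ) : Set (Grid d) := hull (covered ω k) (core ω k)

lemma core_subset_cluster (ω : Field d) (k : ℕ) : core ω k ⊆ cluster ω k :=
  fun x hx => ⟨x, hx, .refl⟩

lemma covered_mono (ω : Field d) : Monotone (covered ω) :=
  monotone_nat_of_le_succ fun _ => Set.subset_union_left

lemma mem_cluster_of_supDist_le {ω : Field d} {k : ℕ} {u v w : Grid d} (hv : v ∈ covered ω k)
    (hw : w ∈ cluster ω k) (hvw : supDist v w ≤ 3) (hvu : supDist v u ≤ 3) : u ∈ cluster ω k := by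
  obtain ⟨x, hx, hxw⟩ := hw
  exact ⟨x, hx, hxw.tail ⟨v, hv, supDist_comm v w ▸ hvw, hvu⟩⟩

lemma supDist_lt_of_mem_centers {ω : Field d} {k : ℕ} {x u : Grid d} (h : u ∈ centers ω k x) :
    supDist x u < 2 * boxRadius k := lt_of_lt_of_le h (min_le_right _ _)

/-- Chains of steps through the vertices of scale less than `k` do not get far: cores of different
clusters of scale `k` are too far from each other to be joined by chains through vertices of smaller
scale, so that a chain meets at most one cluster of scale `k`. -/
lemma supDist_add_two_le_reach (ω : Field d) (k : ℕ) {x y : Grid d}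
    (h : Relation.ReflTransGen (Step (covered ω k)) x y) : supDist x y + 2 ≤ reach k := by
  induction k generalizing x y with
  | zero =>
    rcases Relation.ReflTransGen.cases_head h with rfl | ⟨z, ⟨v, hv, -⟩, -⟩
    · simp [supDist_self, reach]
    · exact absurd hv (Set.notMem_empty v)
  | succ k ih =>
    rw [reach_succ]
    have ha := two_le_reach k
    -- either the chain comes near a cluster of scale `k`, or it is a chain of smaller scale
    by_cases hnear : ∃ v ∈ cluster ω k, supDist x v + 2 ≤ reach k + 3
    · obtain ⟨v₀, ⟨x₀, hx₀, hxv₀⟩, hv₀⟩ := hnear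
      have d₀ := ih hxv₀
      -- `x₁` is a core vertex of the last cluster of scale `k` on the chain, which is left via the
      -- step from `v₁` to `y₁`; it lies in the same boxes as the core vertex `x₀` of the first one
      have key : Relation.ReflTransGen (Step (covered ω k)) x y ∨
          ∃ x₁ ∈ core ω k, centers ω k x₁ = centers ω k x₀ ∧ ∃ v₁ y₁,
            Relation.ReflTransGen (Step (covered ω k)) x₁ v₁ ∧ supDist v₁ y₁ ≤ 3 ∧
            Relation.ReflTransGen (Step (covered ω k)) y₁ y := by
        induction h with
        | refl => exact .inl .refl
        | @tail z y _ hzy ihz =>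
          obtain ⟨v, hv | hv, hzv, hvy⟩ := hzy
          · rcases ihz with h1 | ⟨x₁, hx₁, hS, v₁, y₁, h1, h2, h3⟩
            · exact .inl (h1.tail ⟨v, hv, hzv, hvy⟩)
            · exact .inr ⟨x₁, hx₁, hS, v₁, y₁, h1, h2, h3.tail ⟨v, hv, hzv, hvy⟩⟩
          · obtain ⟨x', hx', hxv'⟩ := hv
            have d' := ih hxv'
            refine .inr ⟨x', hx', ?_, v, y, hxv', hvy, .refl⟩
            have t1 := supDist_triangle x' v z
            rw [supDist_comm v z] at t1
            rcases ihz with h1 | ⟨x₁, hx₁, hS, v₁, y₁, h1, h2, h3⟩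
            · refine (hx'.2 x₀ ?_).symm
              have d1 := ih h1
              have t2 := supDist_triangle x' z x
              have t3 := supDist_triangle x' x v₀
              have t4 := supDist_triangle x' v₀ x₀
              rw [supDist_comm v₀] at t4
              rw [supDist_comm z x] at t2
              omega
            · rw [← hS]
              refine (hx'.2 x₁ ?_).symm
              have d1 := ih h1
              have d2 := ih h3
              have t2 := supDist_triangle x' z y₁
              have t3 := supDist_triangle x' y₁ v₁
              have t4 := supDist_triangle x' v₁ x₁
              rw [supDist_comm v₁] at t4
              rw [supDist_comm z y₁] at t2
              rw [supDist_comm y₁ v₁] at t3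
              omega
      rcases key with h1 | ⟨x₁, hx₁, hS, v₁, y₁, h1, h2, h3⟩
      · have := ih h1
        omega
      · obtain ⟨u, hu⟩ := hx₀.1
        have e1 := supDist_lt_of_mem_centers hu
        have e2 := supDist_lt_of_mem_centers (hS.symm ▸ hu : u ∈ centers ω k x₁)
        have d1 := ih h1
        have d2 := ih h3
        have t1 := supDist_triangle x v₀ x₀
        have t2 := supDist_triangle x x₀ u
        have t3 := supDist_triangle x u x₁
        have t4 := supDist_triangle x x₁ v₁
        have t5 := supDist_triangle x v₁ y₁
        have t6 := supDist_triangle x y₁ y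
        rw [supDist_comm v₀] at t1
        rw [supDist_comm u] at t3
        omega
    · have key : Relation.ReflTransGen (Step (covered ω k)) x y := by
        induction h with
        | refl => exact .refl
        | @tail z y _ hzy ihz =>
          obtain ⟨v, hv | hv, hzv, hvy⟩ := hzy
          · exact ihz.tail ⟨v, hv, hzv, hvy⟩
          · have d1 := ih ihz
            have t1 := supDist_triangle x z v
            exact absurd ⟨v, hv, by omega⟩ hnear
      have := ih key
      omega

lemma exists_core_of_mem_cluster {ω : Field d} {k : ℕ} {y : Grid d} (h : y ∈ cluster ω k) :
    ∃ x ∈ core ω k, supDist x y + 2 ≤ reach k := by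
  obtain ⟨x, hx, hxy⟩ := h
  exact ⟨x, hx, supDist_add_two_le_reach ω k hxy⟩

/-! ### Frames -/

/-- The vertices `v` and `w` have the same parity. -/
def SameParity (v w : Grid d) : Prop := Even (∑ i, (v i - w i))

lemma SameParity.comm {v w : Grid d} : SameParity v w ↔ SameParity w v := by
  unfold SameParity
  rw [← even_neg, ← Finset.sum_neg_distrib]
  simp

lemma sameParity_iff_iff (u v w : Grid d) :
    (SameParity u w ↔ SameParity v w) ↔ SameParity u v := by
  unfold SameParity
  rw [← Int.even_sub, ← Finset.sum_sub_distrib]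
  simp

/-- `u` is the lexicographically smallest element of `S`. -/
def IsLexMin (S : Set (Grid d)) (u : Grid d) : Prop := u ∈ S ∧ ∀ u' ∈ S, toLex u ≤ toLex u'

lemma IsLexMin.unique {S : Set (Grid d)} {u v : Grid d} (hu : IsLexMin S u) (hv : IsLexMin S v) :
    u = v := toLex.injective (le_antisymm (hu.2 v hv.1) (hv.2 u hu.1))

/-- The frame of the clusters of scale `k`: a `2`-coloring of each cluster by parity relative to a
distinguished box center of that cluster. -/
def Frame (ω : Field d) (k : ℕ) (y : Grid d) : Prop :=
  ∃ x ∈ core ω k, supDist x y ≤ reach k ∧ ∃ u, IsLexMin (centers ω k x) u ∧ SameParity y u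

lemma finite_centers (ω : Field d) (k : ℕ) (x : Grid d) : (centers ω k x).Finite := by
  refine (Set.finite_Icc (fun i => x i - 2 * boxRadius k) (fun i => x i + 2 * boxRadius k)).subset
    fun u hu => ?_
  have := supDist_lt_of_mem_centers hu
  constructor <;> intro i <;> have := natAbs_sub_le_supDist x u i <;> simp only <;> omega

lemma exists_isLexMin {ω : Field d} {k : ℕ} {x : Grid d} (h : x ∈ core ω k) :
    ∃ u, IsLexMin (centers ω k x) u := by
  obtain ⟨u, hu, hu'⟩ := Set.exists_min_image _ toLex (finite_centers ω k x) h.1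
  exact ⟨u, hu, hu'⟩

lemma frame_iff {ω : Field d} {k : ℕ} {x y u : Grid d}
    (hu : IsLexMin (centers ω k x) u) (hxy : supDist x y ≤ 2 * reach k) (hy : y ∈ cluster ω k) :
    Frame ω k y ↔ SameParity y u := by
  constructor
  · rintro ⟨x', hx', hxy', u', hu', h⟩
    have t := supDist_triangle x' y x
    rw [supDist_comm y x] at t
    rw [← hx'.2 x (by omega)] at hu'
    rwa [hu.unique hu']
  · intro h
    obtain ⟨x', hx', hxy'⟩ := exists_core_of_mem_cluster hy
    have t := supDist_triangle x' y x
    rw [supDist_comm y x] at t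
    exact ⟨x', hx', by omega, u, hx'.2 x (by omega) ▸ hu, h⟩

lemma frame_iff_frame {ω : Field d} {k : ℕ} {y y' : Grid d} (hy : y ∈ cluster ω k)
    (hy' : y' ∈ cluster ω k) (h : supDist y y' ≤ 3) :
    (Frame ω k y ↔ Frame ω k y') ↔ SameParity y y' := by
  obtain ⟨x, hx, hxy⟩ := exists_core_of_mem_cluster hy
  obtain ⟨u, hu⟩ := exists_isLexMin hx
  have ha := two_le_reach k
  have t := supDist_triangle x y y'
  rw [frame_iff hu (by omega) hy, frame_iff hu (by omega) hy']
  exact sameParity_iff_iff y y' u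

end

section

variable {d : ℕ}

/-! ### The 3-coloring of a hierarchy of clusters -/

open Classical in
/-- The color of height `t` or `t + 1`, whichever has the parity prescribed by `b`. -/
def tint (t : ℕ) (b : Prop) : Fin 3 := if (Even t ↔ b) then Fin.ofNat 3 t else Fin.ofNat 3 (t + 1)

lemma tint_ne_tint {s t : ℕ} (hs : s ≤ 2) (ht : t ≤ 2) (hst : s ≤ t + 1) (hts : t ≤ s + 1)
    {b c : Prop} (h : ¬ (b ↔ c)) : tint s b ≠ tint t c := by
  by_cases hb : b <;> by_cases hc : c <;> simp only [hb, hc, iff_self, not_true_eq_false] at h <;>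
    unfold tint <;> interval_cases s <;> interval_cases t <;>
    simp_all [show ¬ Even 1 by decide] <;> first | omega | decide

/-- Raising the height by `3` is the same as changing the parity. -/
lemma tint_two_ne_tint_zero {b c : Prop} (h : b ↔ c) : tint 2 b ≠ tint 0 c := by
  by_cases hb : b <;> by_cases hc : c <;> simp_all [tint]
  decide

/-- The frame of the largest cluster of scale less than `k` that contains the vertex. -/
def topFrame (ω : Field d) : ℕ → Grid d → Prop
  | 0 => fun _ => False
  | k + 1 => fun v => (v ∈ cluster ω k ∧ Frame ω k v) ∨ (v ∉ cluster ω k ∧ topFrame ω k v)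

/-- The vertices of clusters of scale less than `k` inside a cluster of scale `k` that has another
frame. -/
def flipped (ω : Field d) (k : ℕ) : Set (Grid d) :=
  {v | v ∈ covered ω k ∧ v ∈ cluster ω k ∧ ¬ (topFrame ω k v ↔ Frame ω k v)}

open Classical in
/-- The height level of the vertices that are added at scale `k`: it increases from `0` to `2`
towards the clusters of smaller scale with the opposite frame, where it would be `3`. -/
def level (ω : Field d) (k : ℕ) (v : Grid d) : ℕ :=
  if ∃ w ∈ flipped ω k, supDist v w ≤ 1 then 2 else
  if ∃ w ∈ flipped ω k, supDist v w ≤ 2 then 1 else 0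

open Classical in
/-- The coloring of the vertices of clusters of scale less than `k`: the color of a vertex is fixed
at the smallest scale at which it belongs to a cluster. -/
def partialColor (ω : Field d) : ℕ → Grid d → Fin 3
  | 0 => fun _ => 0
  | k + 1 => fun v =>
    if v ∈ covered ω k then partialColor ω k v else tint (level ω k v) (Frame ω k v)

lemma level_le_two (ω : Field d) (k : ℕ) (v : Grid d) : level ω k v ≤ 2 := by
  unfold level; split_ifs <;> omega

lemma level_le_succ {ω : Field d} {k : ℕ} {v w : Grid d} (h : supDist v w ≤ 1) :
    level ω k v ≤ level ω k w + 1 := by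
  have key : ∀ u, supDist v u ≤ 1 → supDist w u ≤ 2 := fun u hu => by
    have := supDist_triangle w v u
    rw [supDist_comm w v] at this
    omega
  unfold level
  split_ifs with h1 h2 h3 h4 <;> try omega
  obtain ⟨u, hu, hvu⟩ := h1
  exact absurd ⟨u, hu, key u hvu⟩ h3

lemma level_eq_two {ω : Field d} {k : ℕ} {v w : Grid d} (hw : w ∈ flipped ω k)
    (h : supDist v w ≤ 1) : level ω k v = 2 := if_pos ⟨w, hw, h⟩

lemma level_eq_zero {ω : Field d} {k : ℕ} {v : Grid d}
    (h : ∀ w ∈ flipped ω k, ¬ supDist v w ≤ 2) : level ω k v = 0 := by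
  unfold level
  rw [if_neg, if_neg]
  · rintro ⟨w, hw, hvw⟩
    exact h w hw hvw
  · rintro ⟨w, hw, hvw⟩
    exact h w hw (by omega)

/-- The invariants of the coloring at scale `k`: it is proper, each vertex at the boundary of the
colored region has the color prescribed by the frame of its largest cluster, and frames agree
within distance `3`. -/
structure ColoringInvariant (ω : Field d) (k : ℕ) : Prop where
  proper : ∀ v ∈ covered ω k, ∀ w ∈ covered ω k, supDist v w ≤ 1 → ¬ SameParity v w →
    partialColor ω k v ≠ partialColor ω k w
  boundary : ∀ v ∈ covered ω k, ∀ w ∉ covered ω k, supDist v w ≤ 1 →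
    partialColor ω k v = tint 0 (topFrame ω k v)
  frame : ∀ v ∈ covered ω k, ∀ w ∈ covered ω k, supDist v w ≤ 3 →
    ((topFrame ω k v ↔ topFrame ω k w) ↔ SameParity v w)

lemma topFrame_succ_of_mem {ω : Field d} {k : ℕ} {v : Grid d} (h : v ∈ cluster ω k) :
    topFrame ω (k + 1) v ↔ Frame ω k v := by simp [topFrame, h]

lemma topFrame_succ_of_notMem {ω : Field d} {k : ℕ} {v : Grid d} (h : v ∉ cluster ω k) :
    topFrame ω (k + 1) v ↔ topFrame ω k v := by simp [topFrame, h]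

lemma partialColor_succ_of_mem {ω : Field d} {k : ℕ} {v : Grid d} (h : v ∈ covered ω k) :
    partialColor ω (k + 1) v = partialColor ω k v := if_pos h

lemma partialColor_succ_of_notMem {ω : Field d} {k : ℕ} {v : Grid d} (h : v ∉ covered ω k) :
    partialColor ω (k + 1) v = tint (level ω k v) (Frame ω k v) := if_neg h

/-- A vertex of smaller scale and a new vertex next to it get different colors. -/
lemma ColoringInvariant.partialColor_ne {ω : Field d} {k : ℕ} (h : ColoringInvariant ω k)
    {v w : Grid d} (hv : v ∈ covered ω k) (hw : w ∉ covered ω k) (hwc : w ∈ cluster ω k)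
    (hvw : supDist v w ≤ 1) (hpar : ¬ SameParity v w) :
    partialColor ω k v ≠ tint (level ω k w) (Frame ω k w) := by
  rw [h.boundary v hv w hw hvw]
  have hvc : v ∈ cluster ω k :=
    mem_cluster_of_supDist_le hv hwc (by omega) (by rw [supDist_self]; omega)
  have hfr := frame_iff_frame hvc hwc (by omega)
  by_cases hflip : topFrame ω k v ↔ Frame ω k v
  · rw [level_eq_zero]
    · exact tint_ne_tint (by omega) (by omega) (by omega) (by omega)
        (by rw [hflip, hfr]; exact hpar)
    · rintro u ⟨hu, huc, huf⟩ hwu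
      refine huf ?_
      have t := supDist_triangle v w u
      have h1 := h.frame v hv u hu (by omega)
      have h2 := frame_iff_frame hvc huc (by omega)
      tauto
  · rw [level_eq_two ⟨hv, hvc, hflip⟩ (supDist_comm v w ▸ hvw)]
    exact (tint_two_ne_tint_zero (by tauto)).symm

lemma coloringInvariant (ω : Field d) (k : ℕ) : ColoringInvariant ω k := by
  induction k with
  | zero => exact ⟨fun v hv => hv.elim, fun v hv => hv.elim, fun v hv => hv.elim⟩
  | succ k ih =>
    refine ⟨?_, ?_, ?_⟩
    · intro v hv w hw hvw hpar
      by_cases hv' : v ∈ covered ω k <;> by_cases hw' : w ∈ covered ω k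
      · rw [partialColor_succ_of_mem hv', partialColor_succ_of_mem hw']
        exact ih.proper v hv' w hw' hvw hpar
      · rw [partialColor_succ_of_mem hv', partialColor_succ_of_notMem hw']
        exact ih.partialColor_ne hv' hw' (hw.resolve_left hw') hvw hpar
      · rw [partialColor_succ_of_notMem hv', partialColor_succ_of_mem hw']
        exact (ih.partialColor_ne hw' hv' (hv.resolve_left hv') (supDist_comm v w ▸ hvw)
          (SameParity.comm.not.1 hpar)).symm
      · rw [partialColor_succ_of_notMem hv', partialColor_succ_of_notMem hw']
        exact tint_ne_tint (level_le_two _ _ _) (level_le_two _ _ _) (level_le_succ hvw)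
          (level_le_succ (supDist_comm v w ▸ hvw))
          (by rwa [frame_iff_frame (hv.resolve_left hv') (hw.resolve_left hw') (by omega)])
    · intro v hv w hw hvw
      have hw' : w ∉ covered ω k := fun h => hw (.inl h)
      have hwc : w ∉ cluster ω k := fun h => hw (.inr h)
      by_cases hv' : v ∈ covered ω k
      · have hvc : v ∉ cluster ω k := fun h => hwc
          (mem_cluster_of_supDist_le hv' h (by rw [supDist_self]; omega) (by omega))
        rw [partialColor_succ_of_mem hv', ih.boundary v hv' w hw' hvw,
          propext (topFrame_succ_of_notMem hvc)]
      · have hvc := hv.resolve_left hv'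
        rw [partialColor_succ_of_notMem hv', propext (topFrame_succ_of_mem hvc), level_eq_zero]
        rintro u ⟨hu, huc, -⟩ hvu
        have t := supDist_triangle u v w
        rw [supDist_comm u v] at t
        exact hwc (mem_cluster_of_supDist_le hu huc (by rw [supDist_self]; omega) (by omega))
    · intro v hv w hw hvw
      by_cases hvc : v ∈ cluster ω k <;> by_cases hwc : w ∈ cluster ω k
      · rw [topFrame_succ_of_mem hvc, topFrame_succ_of_mem hwc]
        exact frame_iff_frame hvc hwc hvw
      · refine absurd ?_ hwc
        exact mem_cluster_of_supDist_le (hw.resolve_right hwc) hvc (supDist_comm v w ▸ hvw)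
          (by rw [supDist_self]; omega)
      · refine absurd ?_ hvc
        exact mem_cluster_of_supDist_le (hv.resolve_right hvc) hwc hvw
          (by rw [supDist_self]; omega)
      · rw [topFrame_succ_of_notMem hvc, topFrame_succ_of_notMem hwc]
        exact ih.frame v (hv.resolve_right hvc) w (hw.resolve_right hwc) hvw

lemma partialColor_eq_of_le {ω : Field d} {k l : ℕ} (h : k ≤ l) {v : Grid d}
    (hv : v ∈ covered ω k) : partialColor ω l v = partialColor ω k v := by
  induction l, h using Nat.le_induction with
  | base => rfl
  | succ l hl ih => rw [partialColor_succ_of_mem (covered_mono ω hl hv), ih]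

open Classical in
/-- The coloring of the grid that fixes the color of a vertex at the smallest scale at which it
belongs to a cluster. The color `0` is given to vertices that belong to no cluster. -/
def toastColor (ω : Field d) (v : Grid d) : Fin 3 :=
  if h : ∃ k, v ∈ covered ω k then partialColor ω (Nat.find h) v else 0

lemma toastColor_eq {ω : Field d} {k : ℕ} {v : Grid d} (hv : v ∈ covered ω k) :
    toastColor ω v = partialColor ω k v := by
  classical
  have h : ∃ k, v ∈ covered ω k := ⟨k, hv⟩
  unfold toastColor
  rw [dif_pos h]
  exact (partialColor_eq_of_le (Nat.find_min' h hv) (Nat.find_spec h)).symm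

lemma toastColor_ne {ω : Field d} (h : ∀ v, ∃ k, v ∈ covered ω k) (v : Grid d) (i : Fin d) :
    toastColor ω v ≠ toastColor ω (v + Pi.single i 1) := by
  obtain ⟨k, hk⟩ := h v
  obtain ⟨l, hl⟩ := h (v + Pi.single i 1)
  have hk' := covered_mono ω (le_max_left k l) hk
  have hl' := covered_mono ω (le_max_right k l) hl
  rw [toastColor_eq hk', toastColor_eq hl']
  refine (coloringInvariant ω _).proper _ hk' _ hl' ?_ ?_
  · refine supDist_le.2 fun j => ?_
    rcases eq_or_ne j i with rfl | hj <;> simp [*]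
  · simp [SameParity, Pi.single_apply]

end

section

variable {d : ℕ}

/-! ### Locality and equivariance -/

/-- Around `v`, up to distance `l`, the labels of `ω` of scale less than `k` are those of `ω'`
around `t + v`. -/
def Match (ω ω' : Field d) (t : Grid d) (k : ℕ) (v : Grid d) (l : ℕ) : Prop :=
  ∀ j < k, ∀ x, supDist v x ≤ l → ω' j (t + x) = ω j x

lemma Match.symm {ω ω' : Field d} {t v : Grid d} {k l : ℕ} (h : Match ω ω' t k v l) :
    Match ω' ω (-t) k (t + v) l := by
  intro j hj x hx
  have := h j hj (-t + x) (by rwa [← supDist_add_left t, add_neg_cancel_left])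
  rw [add_neg_cancel_left] at this
  exact this.symm

lemma Match.mono {ω ω' : Field d} {t v w : Grid d} {k k' l l' : ℕ} (h : Match ω ω' t k v l)
    (hk : k' ≤ k) (hl : supDist v w + l' ≤ l) : Match ω ω' t k' w l' := by
  intro j hj x hx
  refine h j (by omega) x ?_
  have := supDist_triangle v w x
  omega

lemma Match.mem_centers {ω ω' : Field d} {t x u : Grid d} {k : ℕ}
    (h : Match ω ω' t (k + 1) x (2 * boxRadius k)) (hu : u ∈ centers ω k x) :
    t + u ∈ centers ω' k (t + x) := by
  have h1 := supDist_lt_of_mem_centers hu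
  unfold centers truncRadius at *
  rw [Set.mem_ofPred_eq] at *
  rwa [supDist_add_left, h k k.lt_succ_self u h1.le]

lemma Match.mem_centers_iff {ω ω' : Field d} {t x u : Grid d} {k : ℕ}
    (h : Match ω ω' t (k + 1) x (2 * boxRadius k)) :
    t + u ∈ centers ω' k (t + x) ↔ u ∈ centers ω k x :=
  ⟨fun hu => by simpa only [neg_add_cancel_left] using h.symm.mem_centers hu, h.mem_centers⟩

lemma Match.mem_core {ω ω' : Field d} {t x : Grid d} {k : ℕ}
    (h : Match ω ω' t (k + 1) x (4 * reach k + 2 * boxRadius k)) (hx : x ∈ core ω k) :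
    t + x ∈ core ω' k := by
  have hy : ∀ y, supDist x y ≤ 4 * reach k → ∀ u, t + u ∈ centers ω' k (t + y) ↔
      u ∈ centers ω k y := fun y hy u => (h.mono le_rfl (by omega)).mem_centers_iff
  have hx0 := hy x (by rw [supDist_self]; omega)
  obtain ⟨⟨u, hu⟩, hx⟩ := hx
  refine ⟨⟨t + u, (hx0 u).2 hu⟩, fun y hxy => ?_⟩
  obtain ⟨y, rfl⟩ : ∃ z, y = t + z := ⟨-t + y, by simp⟩
  rw [supDist_add_left] at hxy
  ext u
  obtain ⟨u, rfl⟩ : ∃ z, u = t + z := ⟨-t + u, by simp⟩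
  rw [hx0, hy y hxy, hx y hxy]

lemma Match.mem_cluster_of_covered {ω ω' : Field d} {t v : Grid d} {k : ℕ}
    (hcov : ∀ {w}, Match ω ω' t k w (2 * reach k) → w ∈ covered ω k → t + w ∈ covered ω' k)
    (h : Match ω ω' t (k + 1) v (2 * reach (k + 1))) (hv : v ∈ cluster ω k) :
    t + v ∈ cluster ω' k := by
  obtain ⟨x, hx, hxv⟩ := hv
  have hxv' := supDist_add_two_le_reach ω k hxv
  rw [reach_succ] at h
  have ha := two_le_reach k
  refine ⟨t + x, Match.mem_core (h.mono le_rfl ?_) hx, ?_⟩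
  · rw [supDist_comm v x]
    omega
  · have key : ∀ z, Relation.ReflTransGen (Step (covered ω k)) x z →
        Relation.ReflTransGen (Step (covered ω' k)) (t + x) (t + z) := by
      intro z hxz
      induction hxz with
      | refl => exact .refl
      | @tail z y hxz hzy ih =>
        obtain ⟨u, hu, hzu, huy⟩ := hzy
        refine ih.tail ⟨t + u, hcov (h.mono k.le_succ ?_) hu, ?_, ?_⟩
        · have t1 := supDist_triangle v x u
          have t2 := supDist_triangle x z u
          have t3 := supDist_add_two_le_reach ω k hxz
          rw [supDist_comm v x] at t1
          omega
        · rwa [supDist_add_left]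
        · rwa [supDist_add_left]
    exact key v hxv

lemma Match.mem_covered {ω ω' : Field d} {t v : Grid d} {k : ℕ}
    (h : Match ω ω' t k v (2 * reach k)) (hv : v ∈ covered ω k) : t + v ∈ covered ω' k := by
  induction k generalizing v with
  | zero => exact hv.elim
  | succ k ih =>
    rcases hv with hv | hv
    · refine .inl (ih (h.mono k.le_succ ?_) hv)
      rw [supDist_self, reach_succ]
      omega
    · exact .inr (h.mem_cluster_of_covered (fun hw => ih hw) hv)

lemma Match.mem_covered_iff {ω ω' : Field d} {t v : Grid d} {k : ℕ}
    (h : Match ω ω' t k v (2 * reach k)) : t + v ∈ covered ω' k ↔ v ∈ covered ω k :=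
  ⟨fun hv => by simpa only [neg_add_cancel_left] using h.symm.mem_covered hv, h.mem_covered⟩

lemma Match.mem_cluster_iff {ω ω' : Field d} {t v : Grid d} {k : ℕ}
    (h : Match ω ω' t (k + 1) v (2 * reach (k + 1))) :
    t + v ∈ cluster ω' k ↔ v ∈ cluster ω k :=
  ⟨fun hv => by
    simpa only [neg_add_cancel_left] using
      h.symm.mem_cluster_of_covered (fun hw => hw.mem_covered) hv,
    h.mem_cluster_of_covered fun hw => hw.mem_covered⟩

lemma sameParity_add_left (t v w : Grid d) : SameParity (t + v) (t + w) ↔ SameParity v w := by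
  simp [SameParity]

lemma Match.frame {ω ω' : Field d} {t v : Grid d} {k : ℕ}
    (h : Match ω ω' t (k + 1) v (2 * reach (k + 1))) (hv : Frame ω k v) : Frame ω' k (t + v) := by
  obtain ⟨x, hx, hxv, u, ⟨hu, hmin⟩, hpar⟩ := hv
  rw [reach_succ] at h
  have hM : Match ω ω' t (k + 1) x (4 * reach k + 2 * boxRadius k) :=
    h.mono le_rfl (by rw [supDist_comm v x]; omega)
  have hM' : Match ω ω' t (k + 1) x (2 * boxRadius k) :=
    hM.mono le_rfl (by rw [supDist_self]; omega)
  refine ⟨t + x, hM.mem_core hx, by rwa [supDist_add_left], t + u, ⟨hM'.mem_centers hu, ?_⟩,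
    (sameParity_add_left t v u).2 hpar⟩
  intro u' hu'
  obtain ⟨u', rfl⟩ : ∃ z, u' = t + z := ⟨-t + u', by simp⟩
  rw [toLex_add, toLex_add]
  exact add_le_add_right (hmin u' (hM'.mem_centers_iff.1 hu')) _

lemma Match.frame_iff {ω ω' : Field d} {t v : Grid d} {k : ℕ}
    (h : Match ω ω' t (k + 1) v (2 * reach (k + 1))) : Frame ω' k (t + v) ↔ Frame ω k v :=
  ⟨fun hv => by simpa only [neg_add_cancel_left] using h.symm.frame hv, h.frame⟩

lemma Match.pred {ω ω' : Field d} {t v : Grid d} {k : ℕ}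
    (h : Match ω ω' t (k + 1) v (2 * reach (k + 1))) : Match ω ω' t k v (2 * reach k) :=
  h.mono k.le_succ (by rw [supDist_self, reach_succ]; omega)

lemma Match.topFrame_iff {ω ω' : Field d} {t v : Grid d} {k : ℕ}
    (h : Match ω ω' t k v (2 * reach k)) : topFrame ω' k (t + v) ↔ topFrame ω k v := by
  induction k with
  | zero => rfl
  | succ k ih => simp only [topFrame, h.mem_cluster_iff, h.frame_iff, ih h.pred]

lemma Match.mem_flipped_iff {ω ω' : Field d} {t v : Grid d} {k : ℕ}
    (h : Match ω ω' t (k + 1) v (2 * reach (k + 1))) :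
    t + v ∈ flipped ω' k ↔ v ∈ flipped ω k := by
  simp only [flipped, Set.mem_ofPred_eq, h.pred.mem_covered_iff, h.mem_cluster_iff, h.frame_iff,
    h.pred.topFrame_iff]

lemma Match.level_eq {ω ω' : Field d} {t v : Grid d} {k : ℕ}
    (h : Match ω ω' t (k + 1) v (2 * reach (k + 1) + 2)) : level ω' k (t + v) = level ω k v := by
  classical
  have key : ∀ r ≤ 2, (∃ w ∈ flipped ω' k, supDist (t + v) w ≤ r) ↔
      ∃ w ∈ flipped ω k, supDist v w ≤ r := by
    intro r hr
    constructor
    · rintro ⟨w, hw, hvw⟩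
      obtain ⟨w, rfl⟩ : ∃ z, w = t + z := ⟨-t + w, by simp⟩
      rw [supDist_add_left] at hvw
      exact ⟨w, (h.mono le_rfl (by omega)).mem_flipped_iff.1 hw, hvw⟩
    · rintro ⟨w, hw, hvw⟩
      exact ⟨t + w, (h.mono le_rfl (by omega)).mem_flipped_iff.2 hw, by rwa [supDist_add_left]⟩
  exact if_congr (key 1 (by omega)) rfl (if_congr (key 2 le_rfl) rfl rfl)

lemma Match.partialColor_eq {ω ω' : Field d} {t v : Grid d} {k : ℕ}
    (h : Match ω ω' t k v (2 * reach k + 2)) :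
    partialColor ω' k (t + v) = partialColor ω k v := by
  classical
  induction k with
  | zero => rfl
  | succ k ih =>
    have h' := h.mono (w := v) (l' := 2 * reach (k + 1)) le_rfl (by rw [supDist_self]; omega)
    have h'' := h.mono (w := v) (l' := 2 * reach k + 2) k.le_succ
      (by rw [supDist_self, reach_succ]; omega)
    exact if_congr h'.pred.mem_covered_iff (ih h'') (by rw [h.level_eq, propext h'.frame_iff])

/-- The color of a covered vertex depends only on labels at bounded distance. -/
lemma Match.toastColor_eq {ω ω' : Field d} {t v : Grid d} {k : ℕ}
    (h : Match ω ω' t k v (2 * reach k + 2)) (hv : v ∈ covered ω k) :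
    toastColor ω' (t + v) = toastColor ω v := by
  have h' := h.mono (w := v) (l' := 2 * reach k) le_rfl (by rw [supDist_self]; omega)
  rw [FFIID.toastColor_eq hv, FFIID.toastColor_eq (h'.mem_covered hv), h.partialColor_eq]

lemma toastColor_translate (ω : Field d) (g v : Grid d) :
    toastColor (fun k u => ω k (g + u)) v = toastColor ω (g + v) := by
  have hM : ∀ k l, Match (fun k u => ω k (g + u)) ω g k v l := fun k l j _ x _ => rfl
  by_cases hv : ∃ k, v ∈ covered (fun k u => ω k (g + u)) k
  · obtain ⟨k, hk⟩ := hv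
    exact ((hM k _).toastColor_eq hk).symm
  · have hv' : ¬ ∃ k, g + v ∈ covered ω k := fun ⟨k, hk⟩ =>
      hv ⟨k, (hM k _).mem_covered_iff.1 hk⟩
    unfold toastColor
    rw [dif_neg hv, dif_neg hv']

end

section

variable {d : ℕ}

/-! ### Measurability -/

/-- `y` can be reached from `x` in `n` steps of the relation `R`. Counting the steps exhibits
reachability as a countable union of measurable conditions. -/
def IterRel {α : Type*} (R : α → α → Prop) (x : α) : ℕ → α → Prop
  | 0, y => x = y
  | n + 1, y => ∃ z, IterRel R x n z ∧ R z y

lemma reflTransGen_iff_exists_iterRel {α : Type*} {R : α → α → Prop} {x y : α} :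
    Relation.ReflTransGen R x y ↔ ∃ n, IterRel R x n y := by
  constructor
  · intro h
    induction h with
    | refl => exact ⟨0, rfl⟩
    | tail _ hzy ih =>
      obtain ⟨n, hn⟩ := ih
      exact ⟨n + 1, _, hn, hzy⟩
  · rintro ⟨n, hn⟩
    induction n generalizing y with
    | zero => exact hn ▸ .refl
    | succ n ih =>
      obtain ⟨z, hz, hzy⟩ := hn
      exact (ih hz).tail hzy

lemma measurable_mem_centers (k : ℕ) (x u : Grid d) :
    Measurable fun ω : Field d => u ∈ centers ω k x := by
  have : Measurable fun ω : Field d => truncRadius ω k u := by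
    unfold truncRadius; fun_prop
  exact (Measurable.of_discrete (f := fun n => supDist x u < n)).comp this

lemma measurable_mem_core (k : ℕ) (x : Grid d) : Measurable fun ω : Field d => x ∈ core ω k := by
  have : (fun ω : Field d => x ∈ core ω k) = fun ω => (∃ u, u ∈ centers ω k x) ∧
      ∀ y, supDist x y ≤ 4 * reach k → ∀ u, u ∈ centers ω k y ↔ u ∈ centers ω k x := by
    funext ω
    simp only [core, Set.mem_ofPred_eq, Set.Nonempty, Set.ext_iff]
  rw [this]
  exact (Measurable.exists fun u => measurable_mem_centers k x u).and
    (Measurable.forall fun y => measurable_const.imp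
      (Measurable.forall fun u =>
        (measurable_mem_centers k y u).iff (measurable_mem_centers k x u)))

lemma measurable_mem_cluster_of_covered {k : ℕ}
    (h : ∀ v : Grid d, Measurable fun ω : Field d => v ∈ covered ω k) (v : Grid d) :
    Measurable fun ω : Field d => v ∈ cluster ω k := by
  have hit : ∀ (x : Grid d) n y, Measurable fun ω : Field d =>
      IterRel (Step (covered ω k)) x n y := by
    intro x n
    induction n with
    | zero => exact fun y => measurable_const
    | succ n ih =>
      exact fun y => Measurable.exists fun z => (ih z).and
        (Measurable.exists fun u => (h u).and measurable_const)
  simp only [cluster, hull, Set.mem_ofPred_eq, reflTransGen_iff_exists_iterRel]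
  exact Measurable.exists fun x => (measurable_mem_core k x).and
    (Measurable.exists fun n => hit x n v)

lemma measurable_mem_covered (k : ℕ) (v : Grid d) :
    Measurable fun ω : Field d => v ∈ covered ω k := by
  induction k generalizing v with
  | zero => exact measurable_const
  | succ k ih => exact (ih v).or (measurable_mem_cluster_of_covered ih v)

lemma measurable_mem_cluster (k : ℕ) (v : Grid d) :
    Measurable fun ω : Field d => v ∈ cluster ω k :=
  measurable_mem_cluster_of_covered (measurable_mem_covered k) v

lemma measurable_frame (k : ℕ) (y : Grid d) : Measurable fun ω : Field d => Frame ω k y :=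
  Measurable.exists fun x => (measurable_mem_core k x).and <| measurable_const.and <|
    Measurable.exists fun u => Measurable.and
      ((measurable_mem_centers k x u).and
        (Measurable.forall fun u' => (measurable_mem_centers k x u').imp measurable_const))
      measurable_const

lemma measurable_topFrame (k : ℕ) (v : Grid d) :
    Measurable fun ω : Field d => topFrame ω k v := by
  induction k with
  | zero => exact measurable_const
  | succ k ih =>
    exact ((measurable_mem_cluster k v).and (measurable_frame k v)).or
      ((measurable_mem_cluster k v).not.and ih)

lemma measurable_mem_flipped (k : ℕ) (v : Grid d) :
    Measurable fun ω : Field d => v ∈ flipped ω k :=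
  (measurable_mem_covered k v).and ((measurable_mem_cluster k v).and
    ((measurable_topFrame k v).iff (measurable_frame k v)).not)

lemma measurable_level (k : ℕ) (v : Grid d) : Measurable fun ω : Field d => level ω k v := by
  have h : ∀ r, MeasurableSet {ω : Field d | ∃ w ∈ flipped ω k, supDist v w ≤ r} := fun r =>
    measurableSet_setOfPred.2 <| Measurable.exists fun w =>
      (measurable_mem_flipped k w).and measurable_const
  exact Measurable.ite (h 1) measurable_const (Measurable.ite (h 2) measurable_const
    measurable_const)

lemma measurable_partialColor (k : ℕ) (v : Grid d) :
    Measurable fun ω : Field d => partialColor ω k v := by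
  induction k with
  | zero => exact measurable_const
  | succ k ih =>
    refine Measurable.ite (measurableSet_setOfPred.2 (measurable_mem_covered k v)) ih ?_
    exact (Measurable.of_discrete (f := fun p : ℕ × Prop => tint p.1 p.2)).comp
      ((measurable_level k v).prodMk (measurable_frame k v))

lemma measurable_toastColor (v : Grid d) : Measurable fun ω : Field d => toastColor ω v := by
  refine measurable_to_countable' fun c => ?_
  have : (fun ω : Field d => toastColor ω v) ⁻¹' {c} = {ω | (∃ k, v ∈ covered ω k ∧
      partialColor ω k v = c) ∨ ((∀ k, v ∉ covered ω k) ∧ c = 0)} := by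
    ext ω
    simp only [Set.mem_preimage, Set.mem_singleton_iff, Set.mem_ofPred_eq]
    by_cases h : ∃ k, v ∈ covered ω k
    · obtain ⟨k, hk⟩ := h
      rw [toastColor_eq hk]
      constructor
      · exact fun h => .inl ⟨k, hk, h⟩
      · rintro (⟨l, hl, h⟩ | ⟨h, -⟩)
        · rw [← h, ← toastColor_eq hk, toastColor_eq hl]
        · exact absurd hk (h k)
    · have h0 : toastColor ω v = 0 := dif_neg h
      push Not at h
      simp [h0, h, eq_comm]
  rw [this, measurableSet_setOfPred]
  refine Measurable.or (Measurable.exists fun k => (measurable_mem_covered k v).and ?_)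
    ((Measurable.forall fun k => (measurable_mem_covered k v).not).and measurable_const)
  exact measurableSet_setOfPred.1 (measurable_partialColor k v (measurableSet_singleton c))

end

section

variable {d : ℕ}

/-! ### Random boxes -/

lemma boxRadius_pos (k : ℕ) : 0 < boxRadius k := by
  have := two_le_reach k
  unfold boxRadius
  positivity

lemma four_mul_reach_le_boxRadius (k : ℕ) : 4 * reach k ≤ boxRadius k := by
  unfold boxRadius
  refine Nat.mul_le_mul_right _ ?_
  rw [pow_add]
  have := Nat.one_le_two_pow (n := k)
  omega

/-- The probability that a vertex is the center of a box of scale `k`: about `k + 1` boxes of scale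
`k` are expected to contain a given vertex. -/
def centerProb (d k : ℕ) : ℝ≥0∞ := min 1 ((k + 1 : ℕ) / ((2 * boxRadius k + 1) ^ d : ℕ))

/-- The law of the labels of scale `k`: `0` with probability `1 - centerProb d k`, and otherwise
uniform between `boxRadius k + 1` and `2 * boxRadius k`. -/
def radiusLaw (d k : ℕ) : Measure ℕ :=
  (1 - centerProb d k) • Measure.dirac 0 +
    ∑ i ∈ Finset.range (boxRadius k),
      (centerProb d k / boxRadius k) • Measure.dirac (boxRadius k + 1 + i)

lemma centerProb_le_one (d k : ℕ) : centerProb d k ≤ 1 := min_le_left _ _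

lemma radiusLaw_apply (d k : ℕ) (s : Set ℕ) : radiusLaw d k s =
    (1 - centerProb d k) * s.indicator 1 0 + ∑ i ∈ Finset.range (boxRadius k),
      centerProb d k / boxRadius k * s.indicator 1 (boxRadius k + 1 + i) := by
  simp [radiusLaw]

instance (d k : ℕ) : IsProbabilityMeasure (radiusLaw d k) := by
  constructor
  rw [radiusLaw_apply]
  have h0 : (boxRadius k : ℝ≥0∞) ≠ 0 := by exact_mod_cast (boxRadius_pos k).ne'
  simp [ENNReal.mul_div_cancel h0, tsub_add_cancel_of_le (centerProb_le_one d k)]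

lemma radiusLaw_Iic (d k : ℕ) : radiusLaw d k (Set.Iic (boxRadius k)) = 1 - centerProb d k := by
  rw [radiusLaw_apply, Finset.sum_eq_zero, Set.indicator_of_mem (by simp)]
  · simp
  · intro i _
    rw [Set.indicator_of_notMem (by simp; omega), mul_zero]

/-- The probability that the boundary of a box is near a given vertex at distance `D` from its
center. -/
lemma radiusLaw_near_le (d k D s : ℕ) :
    radiusLaw d k {n | min n (2 * boxRadius k) ≠ 0 ∧ D < min n (2 * boxRadius k) + s ∧
      min n (2 * boxRadius k) ≤ D + s} ≤ centerProb d k / boxRadius k * (2 * s : ℕ) := by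
  classical
  set S := {n | min n (2 * boxRadius k) ≠ 0 ∧ D < min n (2 * boxRadius k) + s ∧
      min n (2 * boxRadius k) ≤ D + s} with hS
  rw [radiusLaw_apply, Set.indicator_of_notMem (by simp [hS]), mul_zero, zero_add, ← Finset.mul_sum]
  gcongr
  have hcard : ((Finset.range (boxRadius k)).filter fun i => boxRadius k + 1 + i ∈ S).card ≤
      2 * s := by
    calc _ ≤ (Finset.Ioc D (D + 2 * s)).card := by
          refine Finset.card_le_card_of_injOn (fun i => boxRadius k + 1 + i + s) ?_ ?_
          · intro i hi
            simp only [hS, Finset.coe_filter, Finset.mem_range, Set.mem_ofPred_eq] at hi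
            simp only [Finset.coe_Ioc, Set.mem_Ioc]
            omega
          · intro i _ j _ hij
            simp only at hij
            omega
      _ = 2 * s := by simp
  calc _ = (((Finset.range (boxRadius k)).filter fun i =>
        boxRadius k + 1 + i ∈ S).card : ℝ≥0∞) := by
        rw [Finset.card_filter, Nat.cast_sum]
        exact Finset.sum_congr rfl fun i _ => by
          by_cases h : boxRadius k + 1 + i ∈ S <;> simp [h]
    _ ≤ (2 * s : ℕ) := by exact_mod_cast hcard

/-- The vertices at `ℓ^∞`-distance at most `r` from `x`. -/
def box (x : Grid d) (r : ℕ) : Finset (Grid d) := Finset.Icc (fun i => x i - r) (fun i => x i + r)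

lemma mem_box {x u : Grid d} {r : ℕ} : u ∈ box x r ↔ supDist x u ≤ r := by
  rw [box, Finset.mem_Icc, supDist_le, Pi.le_def, Pi.le_def, ← forall_and]
  exact forall_congr' fun i => by omega

lemma card_box (x : Grid d) (r : ℕ) : (box x r).card = (2 * r + 1) ^ d := by
  have : ∀ i, (x i + r + 1 - (x i - r) : ℤ).toNat = 2 * r + 1 := fun i => by omega
  simp [box, Pi.card_Icc, this]

/-- The law of the labels of scale `k`. -/
def scaleLaw (d k : ℕ) : Measure (Grid d → ℕ) := Measure.infinitePi fun _ => radiusLaw d k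

instance (d k : ℕ) : IsProbabilityMeasure (scaleLaw d k) := by unfold scaleLaw; infer_instance

lemma one_sub_centerProb_pow_le (hd : 0 < d) (k : ℕ) :
    (1 - centerProb d k) ^ ((2 * boxRadius k + 1) ^ d) ≤ ENNReal.ofReal ((1 / 2) ^ (k + 1)) := by
  set n := (2 * boxRadius k + 1) ^ d with hn
  have hkn : k + 1 ≤ n := by
    have h1 : 2 * boxRadius k + 1 ≤ n := Nat.le_self_pow hd.ne' _
    have h2 := two_le_reach k
    have h3 : k < 2 ^ k := Nat.lt_two_pow_self
    have h4 : boxRadius k = 2 ^ k * (4 * reach k) := by unfold boxRadius; ring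
    have : 2 ^ k * 1 ≤ 2 ^ k * (4 * reach k) := Nat.mul_le_mul_left _ (by omega)
    omega
  have hn0 : (0 : ℝ) < n := by exact_mod_cast (by omega : 0 < n)
  have hle : ((k + 1 : ℕ) : ℝ) / n ≤ 1 := by
    rw [div_le_one hn0]
    exact_mod_cast hkn
  have hc : centerProb d k = ENNReal.ofReal ((k + 1 : ℕ) / n) := by
    rw [ENNReal.ofReal_div_of_pos hn0, ENNReal.ofReal_natCast, ENNReal.ofReal_natCast]
    refine min_eq_right ?_
    rw [← hn]
    exact ENNReal.div_le_of_le_mul (by rw [one_mul]; exact_mod_cast hkn)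
  rw [hc, ← ENNReal.ofReal_one, ← ENNReal.ofReal_sub _ (by positivity),
    ← ENNReal.ofReal_pow (by linarith)]
  refine ENNReal.ofReal_le_ofReal
    ((Real.one_sub_div_pow_le_exp_neg (by exact_mod_cast hkn)).trans ?_)
  have h1 : Real.exp (-1) ≤ 1 / 2 := by
    rw [Real.exp_neg, one_div]
    exact inv_anti₀ (by norm_num) (by linarith [Real.add_one_le_exp (1 : ℝ)])
  calc Real.exp (-((k + 1 : ℕ) : ℝ)) = Real.exp (-1) ^ (k + 1) := by
        rw [← Real.exp_nat_mul]; ring_nf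
    _ ≤ (1 / 2) ^ (k + 1) := pow_le_pow_left₀ (Real.exp_pos _).le h1 _

/-- A bound on the probability that a vertex does not belong to the core of scale `k`. -/
def gapBound (d k : ℕ) : ℝ := 3 ^ (d + 1) * (k + 1) / 2 ^ k

/-- A vertex is outside of the core of scale `k` if no box of this scale contains it, or if it is
near the boundary of one of the boxes of this scale that intersect its neighborhood. -/
lemma scaleLaw_notMem_core_le (hd : 0 < d) (k : ℕ) (x : Grid d) :
    scaleLaw d k {ρ | x ∉ core (fun _ => ρ) k} ≤ ENNReal.ofReal (gapBound d k) := by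
  set r := boxRadius k with hr
  set s := 4 * reach k with hs
  have hr0 : 0 < r := boxRadius_pos k
  have hsr : s ≤ r := four_mul_reach_le_boxRadius k
  set A : Set (Grid d → ℕ) := Set.pi (box x r) fun _ => Set.Iic r with hA
  set N : Grid d → Set ℕ := fun u => {n | min n (2 * r) ≠ 0 ∧ supDist x u < min n (2 * r) + s ∧
      min n (2 * r) ≤ supDist x u + s} with hN
  have hsub : {ρ : Grid d → ℕ | x ∉ core (fun _ => ρ) k} ⊆
      A ∪ ⋃ u ∈ box x (3 * r), (fun ρ => ρ u) ⁻¹' N u := by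
    intro ρ hρ
    by_contra hc
    simp only [Set.mem_union, Set.mem_iUnion, not_or, not_exists] at hc
    obtain ⟨hc1, hc2⟩ := hc
    refine hρ ⟨?_, fun y hy => ?_⟩
    · simp only [hA, Set.mem_pi, Finset.mem_coe, Set.mem_Iic, mem_box, not_forall, not_le] at hc1
      obtain ⟨u, hu, hρu⟩ := hc1
      refine ⟨u, ?_⟩
      change supDist x u < min (ρ u) (2 * boxRadius k)
      omega
    · ext u
      have t1 := supDist_triangle x y u
      have t2 := supDist_triangle y x u
      rw [supDist_comm y x] at t2
      have h1 := hc2 u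
      simp only [mem_box, hN, Set.mem_preimage, Set.mem_ofPred_eq] at h1
      change supDist y u < min (ρ u) (2 * boxRadius k) ↔ supDist x u < min (ρ u) (2 * boxRadius k)
      rw [← hr]
      by_contra hne
      refine h1 ?_ ⟨?_, ?_, ?_⟩ <;> omega
  have hA' : scaleLaw d k A ≤ ENNReal.ofReal ((1 / 2) ^ (k + 1)) := by
    rw [hA, scaleLaw, Measure.infinitePi_pi _ fun _ _ => measurableSet_Iic]
    simp only [hr, radiusLaw_Iic, Finset.prod_const, card_box]
    exact one_sub_centerProb_pow_le hd k
  have hN' : ∀ u, scaleLaw d k ((fun ρ => ρ u) ⁻¹' N u) ≤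
      centerProb d k / boxRadius k * (2 * s : ℕ) := by
    intro u
    rw [← Measure.map_apply (by fun_prop) .of_discrete, scaleLaw, Measure.infinitePi_map_eval]
    exact radiusLaw_near_le d k _ s
  have hcount : ((6 * r + 1) ^ d : ℕ) * (centerProb d k / r * (2 * s : ℕ)) ≤
      ENNReal.ofReal (3 ^ d * (k + 1) * 2 / 2 ^ k) := by
    have hr0' : (0 : ℝ) < r := by exact_mod_cast hr0
    have hn0 : (0 : ℝ) < ((2 * r + 1) ^ d : ℕ) := by positivity
    have hc : centerProb d k ≤ ENNReal.ofReal ((k + 1 : ℕ) / ((2 * r + 1) ^ d : ℕ)) := by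
      rw [ENNReal.ofReal_div_of_pos hn0, ENNReal.ofReal_natCast, ENNReal.ofReal_natCast]
      exact min_le_right _ _
    calc _ ≤ ((6 * r + 1) ^ d : ℕ) *
          (ENNReal.ofReal ((k + 1 : ℕ) / ((2 * r + 1) ^ d : ℕ)) / r * (2 * s : ℕ)) := by gcongr
      _ = ENNReal.ofReal (((6 * r + 1) ^ d : ℕ) *
          ((k + 1 : ℕ) / ((2 * r + 1) ^ d : ℕ) / r * (2 * s : ℕ))) := by
        rw [ENNReal.ofReal_mul (by positivity), ENNReal.ofReal_mul (by positivity),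
          ENNReal.ofReal_div_of_pos hr0', ENNReal.ofReal_natCast, ENNReal.ofReal_natCast,
          ENNReal.ofReal_natCast]
      _ ≤ _ := by
        refine ENNReal.ofReal_le_ofReal ?_
        have hq : ((2 * s : ℕ) : ℝ) = r * (2 / 2 ^ k) := by
          have : r = 2 ^ k * s := by rw [hr, hs, boxRadius]; ring
          rw [this]
          push_cast
          field_simp
        have h6 : (((6 * r + 1) ^ d : ℕ) : ℝ) ≤ 3 ^ d * ((2 * r + 1) ^ d : ℕ) := by
          have := Nat.pow_le_pow_left (by omega : 6 * r + 1 ≤ 3 * (2 * r + 1)) d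
          rw [mul_pow] at this
          exact_mod_cast this
        calc _ ≤ (3 ^ d * ((2 * r + 1) ^ d : ℕ) : ℝ) *
              ((k + 1 : ℕ) / ((2 * r + 1) ^ d : ℕ) / r * (2 * s : ℕ)) := by gcongr
          _ = _ := by
            rw [hq]
            generalize (((2 * r + 1) ^ d : ℕ) : ℝ) = n at hn0
            push_cast
            field_simp
  calc _ ≤ scaleLaw d k A + ∑ u ∈ box x (3 * r), scaleLaw d k ((fun ρ => ρ u) ⁻¹' N u) :=
        (measure_mono hsub).trans ((measure_union_le _ _).trans
          (add_le_add le_rfl (measure_biUnion_finset_le _ _)))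
    _ ≤ ENNReal.ofReal ((1 / 2) ^ (k + 1)) + ENNReal.ofReal (3 ^ d * (k + 1) * 2 / 2 ^ k) := by
        refine add_le_add hA' ((Finset.sum_le_sum fun u _ => hN' u).trans ?_)
        rw [Finset.sum_const, card_box, nsmul_eq_mul, show 2 * (3 * r) + 1 = 6 * r + 1 by ring]
        exact hcount
    _ ≤ ENNReal.ofReal (gapBound d k) := by
        rw [← ENNReal.ofReal_add (by positivity) (by positivity)]
        refine ENNReal.ofReal_le_ofReal ?_
        have h1 : (1 / 2 : ℝ) ^ (k + 1) ≤ 1 / 2 ^ k := by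
          rw [← one_div_pow]
          exact pow_le_pow_of_le_one (by norm_num) (by norm_num) k.le_succ
        have h2 : (1 : ℝ) ≤ 3 ^ d * (k + 1) :=
          one_le_mul_of_one_le_of_one_le (one_le_pow₀ (by norm_num)) (by simp)
        have h3 : (1 : ℝ) / 2 ^ k ≤ 3 ^ d * (k + 1) / 2 ^ k := by gcongr
        calc _ ≤ (3 ^ d * (k + 1) / 2 ^ k + 3 ^ d * (k + 1) * 2 / 2 ^ k : ℝ) := by linarith
          _ = gapBound d k := by unfold gapBound; ring

end

section

variable {d : ℕ}

/-! ### The probability of not being covered -/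

open Filter Topology in
/-- Every moment of order less than `1` of the scale at which a vertex is covered is finite, if the
scale is measured by its `reach`: between consecutive scales the `reach` grows by a factor of order
`2 ^ k`, while the probability of not being covered shrinks by a factor of order `k / 2 ^ k`. -/
lemma summable_reach_rpow_mul_prod_gapBound (d : ℕ) {α : ℝ} (h0 : 0 ≤ α) (h1 : α < 1) :
    Summable fun K => (reach (K + 1) : ℝ) ^ α * ∏ k ∈ Finset.range K, gapBound d k := by
  set q : ℝ := 2 ^ α / 2 with hq
  have hq0 : 0 ≤ q := by positivity
  have hq1 : q < 1 := by
    rw [hq, div_lt_one two_pos]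
    simpa using Real.rpow_lt_rpow_of_exponent_lt one_lt_two h1
  have hlim : Tendsto (fun K : ℕ => 64 * 3 ^ (d + 1) * ((K : ℝ) * q ^ K + q ^ K)) atTop (𝓝 0) := by
    simpa using ((tendsto_self_mul_const_pow_of_lt_one hq0 hq1).add
      (tendsto_pow_atTop_nhds_zero_of_lt_one hq0 hq1)).const_mul (64 * 3 ^ (d + 1))
  have hgap : ∀ k, 0 ≤ gapBound d k := fun k => by unfold gapBound; positivity
  have hf : ∀ K, 0 ≤ (reach (K + 1) : ℝ) ^ α * ∏ k ∈ Finset.range K, gapBound d k := fun K =>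
    mul_nonneg (by positivity) (Finset.prod_nonneg fun k _ => hgap k)
  refine summable_of_ratio_norm_eventually_le (r := 1 / 2) (by norm_num) ?_
  filter_upwards [hlim.eventually_le_const (by norm_num : (0 : ℝ) < 1 / 2)] with K hK
  rw [Real.norm_of_nonneg (hf _), Real.norm_of_nonneg (hf _), Finset.prod_range_succ]
  have hreach : (reach (K + 1 + 1) : ℝ) ≤ (64 * 2 ^ K) * reach (K + 1) := by
    have h2 : 1 ≤ 2 ^ K := Nat.one_le_two_pow
    have h3 : reach (K + 1 + 1) = (4 + 32 * 2 ^ K) * reach (K + 1) := by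
      rw [reach_succ (K + 1), boxRadius]; ring
    rw [h3]
    push_cast
    have h2' : (1 : ℝ) ≤ 2 ^ K := by exact_mod_cast h2
    gcongr
    linarith
  have h64 : (64 : ℝ) ^ α ≤ 64 := by
    simpa using Real.rpow_le_rpow_of_exponent_le (by norm_num : (1 : ℝ) ≤ 64) h1.le
  calc (reach (K + 1 + 1) : ℝ) ^ α * ((∏ k ∈ Finset.range K, gapBound d k) * gapBound d K)
      ≤ ((64 * 2 ^ K) * reach (K + 1)) ^ α *
        ((∏ k ∈ Finset.range K, gapBound d k) * gapBound d K) := by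
        refine mul_le_mul_of_nonneg_right (by gcongr) ?_
        exact mul_nonneg (Finset.prod_nonneg fun k _ => hgap k) (hgap K)
    _ = 64 ^ α * (3 ^ (d + 1) * (K * q ^ K + q ^ K)) *
        ((reach (K + 1) : ℝ) ^ α * ∏ k ∈ Finset.range K, gapBound d k) := by
        rw [Real.mul_rpow (by positivity) (by positivity),
          Real.mul_rpow (by positivity) (by positivity), ← Real.rpow_pow_comm two_pos.le, hq,
          div_pow, gapBound]
        ring
    _ ≤ 1 / 2 * ((reach (K + 1) : ℝ) ^ α * ∏ k ∈ Finset.range K, gapBound d k) := by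
        refine mul_le_mul_of_nonneg_right (le_trans ?_ hK) (hf K)
        rw [mul_assoc]
        gcongr

/-- The law of the label fields: the labels of the different scales are independent. -/
def fieldLaw (d : ℕ) : Measure (Field d) := Measure.infinitePi fun k => scaleLaw d k

/-- The scales are independent, and the core of a scale only depends on the labels of this scale. -/
lemma fieldLaw_notMem_covered_le (hd : 0 < d) (K : ℕ) (v : Grid d) :
    fieldLaw d {ω | v ∉ covered ω K} ≤ ENNReal.ofReal (∏ k ∈ Finset.range K, gapBound d k) := by
  have hsub : {ω : Field d | v ∉ covered ω K} ⊆
      Set.pi (Finset.range K) fun k => {ρ | v ∉ core (fun _ => ρ) k} := by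
    intro ω hω k hk hc
    have hkK : k + 1 ≤ K := Finset.mem_range.1 hk
    exact hω (covered_mono ω hkK (.inr (core_subset_cluster ω k hc)))
  have hm : ∀ k, MeasurableSet {ρ : Grid d → ℕ | v ∉ core (fun _ => ρ) k} := fun k =>
    measurableSet_setOfPred.2 ((measurable_mem_core k v).comp
      (g := fun ω : Field d => v ∈ core ω k) (f := fun ρ _ => ρ) (by fun_prop)).not
  calc _ ≤ fieldLaw d (Set.pi (Finset.range K) fun k => {ρ | v ∉ core (fun _ => ρ) k}) :=
        measure_mono hsub
    _ = ∏ k ∈ Finset.range K, scaleLaw d k {ρ | v ∉ core (fun _ => ρ) k} :=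
        Measure.infinitePi_pi _ fun k _ => hm k
    _ ≤ ∏ k ∈ Finset.range K, ENNReal.ofReal (gapBound d k) :=
        Finset.prod_le_prod' fun k _ => scaleLaw_notMem_core_le hd k v
    _ = _ := (ENNReal.ofReal_prod_of_nonneg fun k _ => by unfold gapBound; positivity).symm

lemma ae_exists_mem_covered (hd : 0 < d) :
    ∀ᵐ ω ∂fieldLaw d, ∀ v, ∃ k, v ∈ covered ω k := by
  refine ae_all_iff.2 fun v => ?_
  have hs := summable_reach_rpow_mul_prod_gapBound d le_rfl one_pos
  simp only [Real.rpow_zero, one_mul] at hs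
  have ht := (ENNReal.continuous_ofReal.tendsto 0).comp hs.tendsto_atTop_zero
  rw [ENNReal.ofReal_zero] at ht
  refine ae_iff.2 (le_antisymm (ge_of_tendsto' ht fun K => ?_) zero_le)
  exact (measure_mono fun ω (hω : ¬ _) (hc : v ∈ covered ω K) => hω ⟨K, hc⟩).trans
    (fieldLaw_notMem_covered_le hd K v)

/-- A single uniform label encodes the labels of all scales of a vertex. -/
lemma exists_measurePreserving_fieldLaw (d : ℕ) : ∃ g : I → ℕ → ℕ, Measurable g ∧
    MeasurePreserving (fun (x : Labeling d) k u => g (x u) k) (iidMeasure d) (fieldLaw d) := by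
  obtain ⟨g, hg, hmap⟩ :=
    Measure.exists_measurable_map_eq (Measure.infinitePi fun k => radiusLaw d k)
  refine ⟨g, hg, by fun_prop, ?_⟩
  have h1 : (iidMeasure d).map (fun x u => g (x u)) =
      Measure.infinitePi fun _ : Grid d => Measure.infinitePi fun k => radiusLaw d k := by
    unfold iidMeasure
    rw [Measure.infinitePi_map_pi _ fun _ => hg]
    simp only [hmap]
  have h2 := Measure.infinitePi_map_curry_symm fun (_ : Grid d) k => radiusLaw d k
  have h3 := Measure.map_infinitePi_infinitePi_of_inj
    (P := fun p : Grid d × ℕ => radiusLaw d p.2) (f := Prod.swap) Prod.swap_injective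
  have h4 := Measure.infinitePi_map_curry fun k (_ : Grid d) => radiusLaw d k
  rw [fieldLaw]
  unfold scaleLaw
  rw [← h4]
  refine Eq.trans ?_ (congrArg (Measure.map _) h3)
  rw [← h2, ← h1, Measure.map_map (by fun_prop) (by fun_prop),
    Measure.map_map (by fun_prop) (by fun_prop), Measure.map_map (by fun_prop) (by fun_prop)]
  rfl

/-! ### The coloring as a finitary factor -/

/-- The coloring of the grid that is read off the iid labels, if the map `g` decodes the label of a
vertex into its labels at all scales. -/
def toastFactor (g : I → ℕ → ℕ) (x : Labeling d) : Grid d → Fin 3 :=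
  toastColor fun k u => g (x u) k

lemma determinedAt_toastFactor {g : I → ℕ → ℕ} {x : Labeling d} {k : ℕ}
    (h : (0 : Grid d) ∈ covered (fun k u => g (x u) k) k) :
    DeterminedAt (toastFactor g) x (3 * d * reach k) := by
  intro x' hx'
  have hM : Match (fun k u => g (x u) k) (fun k u => g (x' u) k) 0 k 0 (2 * reach k + 2) := by
    intro j _ y hy
    dsimp only
    rw [zero_add, hx' y]
    change ∑ i, (y i).natAbs ≤ _
    calc ∑ i, (y i).natAbs ≤ ∑ i : Fin d, (2 * reach k + 2) := by
          refine Finset.sum_le_sum fun i _ => ?_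
          have := supDist_le.1 hy i
          simpa using this
      _ ≤ 3 * d * reach k := by
          have := two_le_reach k
          rw [Finset.sum_const, Finset.card_univ, Fintype.card_fin, smul_eq_mul, mul_comm 3 d,
            mul_assoc]
          exact Nat.mul_le_mul_left _ (by omega)
  have := hM.toastColor_eq h
  rw [zero_add] at this
  exact this

lemma isFFIIDSolution_toastFactor (hd : 0 < d) {g : I → ℕ → ℕ} (hg : Measurable g)
    (hg' : MeasurePreserving (fun (x : Labeling d) k u => g (x u) k) (iidMeasure d) (fieldLaw d)) :
    IsFFIIDSolution (properColoring d 3) (toastFactor g : Labeling d → Grid d → Fin 3) := by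
  have hcov := hg'.quasiMeasurePreserving.ae (ae_exists_mem_covered hd)
  refine ⟨⟨?_, fun t x => ?_, ?_⟩, ?_⟩
  · exact measurable_pi_lambda _ fun v => (measurable_toastColor v).comp (by fun_prop)
  · funext v
    exact toastColor_translate (fun k u => g (x u) k) t v
  · filter_upwards [hcov] with x hx
    obtain ⟨k, hk⟩ := hx 0
    exact (codingRadius_le (determinedAt_toastFactor hk)).trans_lt (ENat.natCast_lt_top _)
  · filter_upwards [hcov] with x hx
    exact mem_solutions_properColoring.2 (toastColor_ne hx)

lemma codingMoment_toastFactor_lt_top (hd : 0 < d) {g : I → ℕ → ℕ}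
    (hg' : MeasurePreserving (fun (x : Labeling d) k u => g (x u) k) (iidMeasure d) (fieldLaw d))
    {α : ℝ} (h0 : 0 ≤ α) (h1 : α < 1) :
    codingMoment (toastFactor g : Labeling d → Grid d → Fin 3) α < ⊤ := by
  have hcov := hg'.quasiMeasurePreserving.ae (ae_exists_mem_covered hd)
  set S : ℕ → Set (Labeling d) := fun K => {x | (0 : Grid d) ∉ covered (fun k u => g (x u) k) K}
  have hS : ∀ K, MeasurableSet (S K) := fun K => hg'.measurable
    (measurableSet_setOfPred.2 (measurable_mem_covered K (0 : Grid d)).not)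
  have hSle : ∀ K, iidMeasure d (S K) ≤ ENNReal.ofReal (∏ k ∈ Finset.range K, gapBound d k) := by
    intro K
    have := hg'.measure_preimage (measurableSet_setOfPred.2
      (measurable_mem_covered K (0 : Grid d)).not).nullMeasurableSet
    exact this.trans_le (fieldLaw_notMem_covered_le hd K 0)
  have hpt : ∀ᵐ x ∂iidMeasure d,
      ((codingRadius (toastFactor g : Labeling d → Grid d → Fin 3) x : ℕ∞) : ℝ≥0∞) ^ α ≤
        ∑' K, (S K).indicator (fun _ => ((3 * d * reach (K + 1) : ℕ) : ℝ≥0∞) ^ α) x := by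
    filter_upwards [hcov] with x hx
    classical
    -- the origin is covered for the first time at some `K + 1`, as nothing is covered at `0`
    have hx0 := hx 0
    obtain ⟨K, hK⟩ : ∃ K, Nat.find hx0 = K + 1 := by
      refine Nat.exists_eq_succ_of_ne_zero fun h => ?_
      have := Nat.find_spec hx0
      rw [h] at this
      exact this
    have hspec := Nat.find_spec hx0
    have hmin := Nat.find_min hx0 (m := K) (by omega)
    rw [hK] at hspec
    refine le_trans ?_ (ENNReal.le_tsum K)
    rw [Set.indicator_of_mem (show x ∈ S K from hmin)]
    refine ENNReal.rpow_le_rpow ?_ h0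
    exact_mod_cast codingRadius_le (determinedAt_toastFactor hspec)
  have hterm : ∀ K, ((3 * d * reach (K + 1) : ℕ) : ℝ≥0∞) ^ α * iidMeasure d (S K) ≤
      ENNReal.ofReal ((3 * d : ℕ) ^ α *
        ((reach (K + 1) : ℝ) ^ α * ∏ k ∈ Finset.range K, gapBound d k)) := by
    intro K
    rw [← mul_assoc, ← Real.mul_rpow (by positivity) (by positivity),
      ENNReal.ofReal_mul (by positivity), ← ENNReal.ofReal_rpow_of_nonneg (by positivity) h0,
      ← Nat.cast_mul, ENNReal.ofReal_natCast]
    exact mul_le_mul' le_rfl (hSle K)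
  calc _ ≤ ∫⁻ x, ∑' K, (S K).indicator (fun _ => ((3 * d * reach (K + 1) : ℕ) : ℝ≥0∞) ^ α) x
        ∂iidMeasure d := lintegral_mono_ae hpt
    _ = ∑' K, ((3 * d * reach (K + 1) : ℕ) : ℝ≥0∞) ^ α * iidMeasure d (S K) := by
        rw [lintegral_tsum fun K => (measurable_const.indicator (hS K)).aemeasurable]
        exact tsum_congr fun K => lintegral_indicator_const (hS K) _
    _ ≤ ∑' K, ENNReal.ofReal ((3 * d : ℕ) ^ α *
        ((reach (K + 1) : ℝ) ^ α * ∏ k ∈ Finset.range K, gapBound d k)) :=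
        ENNReal.tsum_le_tsum hterm
    _ < ⊤ := ((summable_reach_rpow_mul_prod_gapBound d h0 h1).mul_left _).tsum_ofReal_lt_top

/-! ### The moment invariant -/

theorem exists_isFFIIDSolution_codingMoment_lt_top (hd : 0 < d) :
    ∃ F : Labeling d → Grid d → Fin 3, IsFFIIDSolution (properColoring d 3) F ∧
      ∀ α : ℝ, 0 ≤ α → α < 1 → codingMoment F α < ⊤ := by
  obtain ⟨g, hg, hg'⟩ := exists_measurePreserving_fieldLaw d
  exact ⟨toastFactor g, isFFIIDSolution_toastFactor hd hg hg',
    fun α h0 h1 => codingMoment_toastFactor_lt_top hd hg' h0 h1⟩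

lemma codingMoment_one_le {b : ℕ} (F : Labeling d → Grid d → Fin b) {α : ℝ} (hα : 1 ≤ α) :
    codingMoment F 1 ≤ 1 + codingMoment F α := by
  calc codingMoment F 1 ≤ ∫⁻ x, 1 + ((codingRadius F x : ℕ∞) : ℝ≥0∞) ^ α ∂iidMeasure d := by
        refine lintegral_mono fun x => ?_
        rw [ENNReal.rpow_one]
        rcases le_total ((codingRadius F x : ℕ∞) : ℝ≥0∞) 1 with h | h
        · exact h.trans le_self_add
        · refine le_trans ?_ le_add_self
          simpa using ENNReal.rpow_le_rpow_of_exponent_le h hα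
    _ = 1 + codingMoment F α := by
        rw [lintegral_add_left measurable_const, lintegral_one, measure_univ, codingMoment]

theorem momentInvariant_properColoring (hd : 1 < d) :
    momentInvariant (properColoring d 3) = 1 := by
  refine le_antisymm (iSup₂_le fun α hα => ?_) (le_of_forall_lt fun c hc => ?_)
  · obtain ⟨F, hF, hα⟩ := hα
    by_contra! h
    have h1 : (1 : ℝ) ≤ α := by exact_mod_cast h.le
    have := codingMoment_one_le F h1
    rw [codingMoment_one_eq_top hd hF, top_le_iff] at this
    exact (ENNReal.add_lt_top.2 ⟨ENNReal.one_lt_top, hα⟩).ne this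
  · obtain ⟨α, hcα, hα⟩ := ENNReal.lt_iff_exists_nnreal_btwn.1 hc
    obtain ⟨F, hF, hm⟩ := exists_isFFIIDSolution_codingMoment_lt_top (d := d) (by omega)
    exact hcα.trans_le (le_iSup₂_of_le α ⟨F, hF, hm α α.2 (by exact_mod_cast hα)⟩ le_rfl)

end

end FFIID

end

theorem mainTheorem2 (d : ℕ) (hd : 1 < d) :
    (∀ F : FFIID.Labeling d → FFIID.Grid d → Fin 3,
      FFIID.IsFFIIDSolution (FFIID.properColoring d 3) F → FFIID.codingMoment F 1 = ⊤) ∧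
    (∃ F : FFIID.Labeling d → FFIID.Grid d → Fin 3,
      FFIID.IsFFIIDSolution (FFIID.properColoring d 3) F ∧
      ∀ ε : ℝ, 0 < ε → ε ≤ 1 → FFIID.codingMoment F (1 - ε) < ⊤) ∧
    FFIID.momentInvariant (FFIID.properColoring d 3) = 1 := by
  refine ⟨fun F hF => FFIID.codingMoment_one_eq_top hd hF, ?_,
    FFIID.momentInvariant_properColoring hd⟩
  obtain ⟨F, hF, hm⟩ := FFIID.exists_isFFIIDSolution_codingMoment_lt_top (d := d) (by omega)
  exact ⟨F, hF, fun ε h0 h1 => hm (1 - ε) (by linarith) (by linarith)⟩
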